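/- All tournaments are finite. A tournament $T$ contains a tournament $H$ if $H$ is isomorphic to a subtournament of $T$ induced on some vertex set, and $T$ is $\mathcal H$-free, for a set $\mathcal H$ of tournaments, if it contains no member of $\mathcal H$. A $k$-coloring of $T$ is a map from $V(T)$ to a set of $k$ colors such that each color class induces a subtournament without directed cycles; $\chi(T)$ is the least $k$ for which a $k$-coloring exists. For tournaments $F$ and $H$, $H$ is an $F$-hero if there is a constant $c$ such that every $\{F,H\}$-free tournament $T$ satisfies $\chi(T)\le c$. For odd $m\ge 3$ and tournaments $T_1,\dots,T_m$, let $\Delta(T_1,\dots,T_m)$ be the tournament obtained from the disjoint union of $T_1,\dots,T_m$ by adding, for all $1\le i<j\le m$, all edges from $V(T_j)$ to $V(T_i)$ if $i$ and $j$ are both odd, and all edges from $V(T_i)$ to $V(T_j)$ otherwise. Let $I$ be the one-vertex tournament, let $D_1=I$ and $D_n=\Delta(I,D_{n-1},D_{n-1})$ for $n\ge 2$, and let $U_3=\Delta(I,I,I,I,I)$. Let $\mathcal D$ be the closure of $\{D_n : n\ge 1\}$, that is, the smallest class of tournaments (considered up to isomorphism) that contains every $D_n$ and contains every subtournament of each of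 its members, and let $\mathcal D'$ be the class of those $D\in\mathcal D$ that contain $D_3$. **Theorem.** (a) For every $D\in\mathcal D'$, the tournament $U_3$ is a $D$-hero. (b) For every integer $n\ge 2$, every $\{D_n,U_3\}$-free tournament is $3^{n-2}$-colorable. -/

import Mathlib

universe u

/-- A (finite) tournament: a finite loopless digraph in which any two distinct vertices are joined
by exactly one directed edge. `T.Adj u v` says that `uv` is an edge of `T`. -/
structure Tournament : Type (u + 1) where
  V : Type u
  [finite : Finite V]
  toDigraph : Digraph V
  loopless : ∀ v, ¬ toDigraph.Adj v v
  adj_xor : ∀ v w, v ≠ w → Xor (toDigraph.Adj v w) (toDigraph.Adj w v)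

namespace Tournament

instance (T : Tournament.{u}) : Finite T.V := T.finite

/-- The edge relation of a tournament. -/
def Adj (T : Tournament.{u}) (v w : T.V) : Prop := T.toDigraph.Adj v w

/-- The subtournament `T|S` induced on a set `S` of vertices. -/
def induce (T : Tournament.{u}) (S : Set T.V) : Tournament.{u} where
  V := S
  toDigraph := ⟨fun v w => T.Adj v w⟩
  loopless v := T.loopless v
  adj_xor v w h := T.adj_xor v w (fun h' => h (Subtype.ext h'))

/-- `T` contains `H`: the tournament `H` is isomorphic to a subtournament of `T`. -/
def Contains (T H : Tournament.{u}) : Prop :=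
  ∃ S : Set T.V, Nonempty (H.Adj ≃r (T.induce S).Adj)

/-- `T` is `ℋ`-free: it contains no member of `ℋ`. -/
def Free (ℋ : Set Tournament.{u}) (T : Tournament.{u}) : Prop :=
  ∀ H ∈ ℋ, ¬ T.Contains H

/-- A set `S` of vertices is transitive if `T|S` has no directed cycle
(equivalently, no closed directed walk of positive length). -/
def IsTransitiveSet (T : Tournament.{u}) (S : Set T.V) : Prop :=
  ∀ v, ¬ Relation.TransGen (T.induce S).Adj v v

/-- `T` admits a `k`-coloring: a map to a `k`-element set all of whose fibres are transitive. -/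
def Colorable (T : Tournament.{u}) (k : ℕ) : Prop :=
  ∃ φ : T.V → Fin k, ∀ c, T.IsTransitiveSet (φ ⁻¹' {c})

/-- Every tournament is colorable with as many colors as it has vertices. -/
theorem colorable_card (T : Tournament.{u}) : T.Colorable (Nat.card T.V) := by
  refine ⟨Finite.equivFin T.V, fun c v h => ?_⟩
  obtain ⟨w, hw, -⟩ := Relation.TransGen.head'_iff.1 h
  have hvw : v = w := by
    apply Subtype.ext
    apply (Finite.equivFin T.V).injective
    exact (v.2 : _ = c).trans (w.2 : _ = c).symm
  subst hvw
  exact T.loopless _ hw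

/-- The chromatic number: the least `k` such that `T` admits a `k`-coloring
(such a `k` exists by `colorable_card`). -/
noncomputable def chromaticNumber (T : Tournament.{u}) : ℕ := sInf {k | T.Colorable k}

/-- A class of tournaments is hereditary if it contains every subtournament of each of its members
(tournaments being considered up to isomorphism). -/
def Hereditary (𝒯 : Set Tournament.{u}) : Prop :=
  ∀ T ∈ 𝒯, ∀ H, T.Contains H → H ∈ 𝒯

/-- The closure of `𝒯`: the smallest hereditary class containing `𝒯`. -/
def hereditaryClosure (𝒯 : Set Tournament.{u}) : Set Tournament.{u} :=
  ⋂₀ {𝒞 | Hereditary 𝒞 ∧ 𝒯 ⊆ 𝒞}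

/-- `H` is an `F`-hero: the `{F, H}`-free tournaments have bounded chromatic number. -/
def IsHeroFor (F H : Tournament.{u}) : Prop :=
  ∃ c : ℕ, ∀ T : Tournament.{u}, T.Free {F, H} → T.chromaticNumber ≤ c

/-- The edges of `Δ(T_1, …, T_m)`. The part `T_{i+1}` is the family member with index `i : Fin m`.
For parts numbered `i < j` (counting from one), all edges go from the `j`-th part to the `i`-th if
`i` and `j` are both odd, and from the `i`-th part to the `j`-th otherwise. -/
inductive DeltaAdj {m : ℕ} (T : Fin m → Tournament.{u}) :
    (Σ i, (T i).V) → (Σ i, (T i).V) → Prop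
  | within (i : Fin m) (v w : (T i).V) (h : (T i).Adj v w) : DeltaAdj T ⟨i, v⟩ ⟨i, w⟩
  | forward (i j : Fin m) (v : (T i).V) (w : (T j).V) (hij : i < j)
      (h : ¬ (Odd (i.val + 1) ∧ Odd (j.val + 1))) : DeltaAdj T ⟨i, v⟩ ⟨j, w⟩
  | backward (i j : Fin m) (v : (T i).V) (w : (T j).V) (hij : i < j)
      (h : Odd (i.val + 1) ∧ Odd (j.val + 1)) : DeltaAdj T ⟨j, w⟩ ⟨i, v⟩

/-- The tournament `Δ(T_1, …, T_m)`. For `m = 3` this is the tournament with a trisection into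
`T_1 ⇒ T_2 ⇒ T_3 ⇒ T_1`. -/
def delta {m : ℕ} (T : Fin m → Tournament.{u}) : Tournament.{u} where
  V := Σ i, (T i).V
  toDigraph := ⟨DeltaAdj T⟩
  loopless := by
    rintro ⟨i, v⟩ h
    cases h with
    | within _ _ _ h => exact (T i).loopless v h
    | forward _ _ _ _ hij => exact lt_irrefl _ hij
    | backward _ _ _ _ hij => exact lt_irrefl _ hij
  adj_xor := by
    rintro ⟨i, v⟩ ⟨j, w⟩ hne
    rcases lt_trichotomy i j with hij | rfl | hij
    · by_cases ho : Odd (i.val + 1) ∧ Odd (j.val + 1)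
      · refine Or.inr ⟨.backward i j v w hij ho, fun h => ?_⟩
        cases h with
        | within => exact lt_irrefl _ hij
        | forward _ _ _ _ _ h => exact h ho
        | backward _ _ _ _ h => exact lt_asymm hij h
      · refine Or.inl ⟨.forward i j v w hij ho, fun h => ?_⟩
        cases h with
        | within => exact lt_irrefl _ hij
        | forward _ _ _ _ h => exact lt_asymm hij h
        | backward _ _ _ _ _ h => exact ho h
    · have key : ∀ a b : (T i).V, DeltaAdj T ⟨i, a⟩ ⟨i, b⟩ ↔ (T i).Adj a b := by
        intro a b
        refine ⟨fun h => ?_, fun h => .within i a b h⟩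
        cases h with
        | within _ _ _ h => exact h
        | forward _ _ _ _ hij => exact absurd hij (lt_irrefl _)
        | backward _ _ _ _ hij => exact absurd hij (lt_irrefl _)
      have hvw : v ≠ w := fun h => hne (by rw [h])
      have := (T i).adj_xor v w hvw
      simp only [key]
      exact this
    · by_cases ho : Odd (j.val + 1) ∧ Odd (i.val + 1)
      · refine Or.inl ⟨.backward j i w v hij ho, fun h => ?_⟩
        cases h with
        | within => exact lt_irrefl _ hij
        | forward _ _ _ _ _ h => exact h ho
        | backward _ _ _ _ h => exact lt_asymm hij h
      · refine Or.inr ⟨.forward j i w v hij ho, fun h => ?_⟩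
        cases h with
        | within => exact lt_irrefl _ hij
        | forward _ _ _ _ h => exact lt_asymm hij h
        | backward _ _ _ _ _ h => exact ho h

/-- The one-vertex tournament `I`. -/
def I : Tournament.{u} where
  V := PUnit
  toDigraph := ⟨fun _ _ => False⟩
  loopless _ h := h
  adj_xor v w h := absurd (Subsingleton.elim v w) h

/-- The tournaments `D_n`, `n ≥ 1`: `D_1 = I` and `D_n = Δ(I, D_{n-1}, D_{n-1})` for `n ≥ 2`.
The value at `0` is a dummy value, which is never used. -/
def D : ℕ → Tournament.{u}
  | 0 => I
  | 1 => I
  | n + 2 => delta ![I, D (n + 1), D (n + 1)]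

/-- `U_3 = Δ(I, I, I, I, I)`. -/
def U₃ : Tournament.{u} := delta ![I, I, I, I, I]

/-- The class `𝒟`: the closure of `{D_n | n ≥ 1}`. -/
def classD : Set Tournament.{u} := hereditaryClosure {T | ∃ n : ℕ, 1 ≤ n ∧ T = D n}

/-- The class `𝒟'`: the members of `𝒟` that contain `D_3`. -/
def classD' : Set Tournament.{u} := {T | T ∈ classD ∧ T.Contains (D 3)}

end Tournament

/-! Part (a) follows from (b): a member of `classD` embeds in some `D n`, so excluding it excludes
`D n`. Part (b) goes by induction on the number of vertices, for all `n` at once. Partition the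
vertices into modules by a coarsest nontrivial congruence; the quotient is then prime, and still
`U₃`-free. When `D (n + 3)` is excluded, call a class heavy if it contains `D (n + 2)`. No edge
between heavy classes lies in a cyclic triangle of the quotient, since such a triangle would yield
`D (n + 3)`. If three vertex sets cover the quotient, and each of them together with the heavy
classes spans no cyclic triangle, then give each set its own palette of `3 ^ n` colors. Light
classes use the palette of their set and heavy classes use all three palettes.

The core is `exists_cover`, which supplies these sets for a prime `U₃`-free tournament. Let T5 be
the regular tournament on `Fin 5` with edges `i → i + 1, i + 2`.

Without T5, there is a 3-coloring in which every cyclic triangle is rainbow. Fix a cyclic triangle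
and replace its vertices one at a time in all possible ways. A vertex can only ever occupy one of
the three positions (`IsLocal.consistent`), and by primality every vertex occurs; its position is
its color. A triangle that is not rainbow would be monochromatic, and would produce a nontrivial
module.

With T5, the same replacement process on copies of T5 shows that all in- and out-neighborhoods are
transitive (`out_transitive`, `in_transitive`). The sets are then the out-neighborhood of a vertex
`g`, its in-neighborhood, and `{g}`, with `g` heavy if possible. -/

namespace TournamentRel

/-! ### Tournament relations and modules, in a form that applies directly to quotients -/

variable {V : Type*} {R : V → V → Prop}

/-- The relation is that of a tournament. -/
structure IsTour (R : V → V → Prop) : Prop where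
  asymm : ∀ {u v}, R u v → ¬ R v u
  total : ∀ {u v}, u ≠ v → R u v ∨ R v u

/-- No copy of `U₃`. -/
def NoU (R : V → V → Prop) : Prop :=
  ∀ a b c d e, R a b → R b c → R c d → R d e → R a d → R b d → R b e → R c a → R e a → R e c → False

/-- No copy of the regular tournament on five vertices with edges `i → i + 1, i + 2`. -/
def NoT5 (R : V → V → Prop) : Prop :=
  ∀ a b c d e, R a b → R b c → R c d → R d e → R e a → R a c → R b d → R c e → R d a → R e b → False

/-- A module (homogeneous set). -/
def IsMod (R : V → V → Prop) (M : Set V) : Prop :=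
  ∀ v, v ∉ M → ∀ u ∈ M, ∀ u' ∈ M, R u v → ¬ R v u'

/-- All modules are trivial. -/
def IsPrime (R : V → V → Prop) : Prop :=
  ∀ M : Set V, IsMod R M → M.Subsingleton ∨ M = Set.univ

/-- Tournaments without copies of `U₃` and of the regular five-vertex tournament above. -/
structure IsLocal (R : V → V → Prop) : Prop extends IsTour R where
  noU : NoU R
  noT : NoT5 R

theorem IsTour.irrefl (h : IsTour R) (v : V) : ¬ R v v := fun hv => h.asymm hv hv

theorem IsTour.of_not (h : IsTour R) {u v : V} (hne : u ≠ v) (hn : ¬ R u v) : R v u :=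
  (h.total hne).resolve_left hn

theorem IsLocal.flip (h : IsLocal R) : IsLocal (_root_.flip R) where
  asymm := fun huv => h.asymm huv
  total := fun hne => (h.total hne).symm
  noU := fun a b c d e h1 h2 h3 h4 h5 h6 h7 h8 h9 h10 =>
    h.noU e d c b a h4 h3 h2 h1 h7 h6 h5 h10 h9 h8
  noT := fun a b c d e h1 h2 h3 h4 h5 h6 h7 h8 h9 h10 =>
    h.noT e d c b a h4 h3 h2 h1 h5 h8 h7 h6 h10 h9

/-! ### Five-vertex configurations excluded by `U₃` and T5 -/

section Explicit

/-- Here `w` could replace `y` in the triangle `x y z` but `z` in the triangle `x' y z`. The five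
vertices form `U₃` or T5, depending on the direction of the edge between `x` and `x'`. -/
theorem IsLocal.adj_conflict (h : IsLocal R) {x y z x' w : V} (hxy : R x y) (hyz : R y z)
    (hzx : R z x) (hxy' : R x' y) (hzx' : R z x') (hxw : R x w) (hwz : R w z) (hyw : R y w)
    (hwx' : R w x') : False := by
  have hne : x ≠ x' := by rintro rfl; exact h.asymm hxw hwx'
  rcases h.total hne with hx | hx
  · exact h.noU z x w x' y hzx hxw hwx' hxy' hzx' hx hxy hwz hyz hyw
  · exact h.noT x y w z x' hxy hyw hwz hzx' hx hxw hyz hwx' hzx hxy'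

/-- This and the next two lemmas serve `IsLocal.back_step`: `x → w` points backwards over `b`, `c`,
and each excludes one wrong behavior of the third vertex `a`. -/
theorem IsLocal.no_below_back (h : IsLocal R) {a b c x w : V} (hab : R a b) (hbc : R b c)
    (hca : R c a) (hax : R a x) (hbx : R b x) (hcx : R c x) (hxw : R x w) (haw : R a w)
    (hwb : R w b) (hwc : R w c) : False :=
  h.noU c a b x w hca hab hbx hxw hcx hax haw hbc hwc hwb

theorem IsLocal.no_above_back (h : IsLocal R) {a b c x w : V} (hab : R a b) (hbc : R b c)
    (hca : R c a) (hwa : R w a) (hwb : R w b) (hwc : R w c) (hxw : R x w) (hxa : R x a)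
    (hbx : R b x) (hcx : R c x) : False :=
  h.noU x w c a b hxw hwc hca hab hxa hwa hwb hcx hbx hbc

theorem IsLocal.no_back_path (h : IsLocal R) {a b c x w : V} (hab : R a b) (hbc : R b c)
    (hca : R c a) (hxa : R x a) (haw : R a w) (hxw : R x w) (hbx : R b x) (hcx : R c x)
    (hwb : R w b) (hwc : R w c) : False :=
  h.noT a w b c x haw hwb hbc hcx hxa hab hwc hbx hca hxw

theorem IsLocal.two_conflict (h : IsLocal R) {a b c x u w : V} (hab : R a b) (hbc : R b c)
    (hca : R c a) (hxb : R x b) (hcx : R c x) (hau : R a u) (huc : R u c) (hwa : R w a)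
    (hwc : R w c) (hxw : R x w) (huw : R u w) : False := by
  have hne : x ≠ u := by rintro rfl; exact h.asymm huc hcx
  have hne' : a ≠ x := by rintro rfl; exact h.asymm hwa hxw
  rcases h.total hne with hxu | hux
  · exact h.adj_conflict hxu huc hcx hau hca hxw hwc huw hwa
  · rcases h.total hne' with hax | hxa
    · exact h.no_below_back huc hca hau hux hcx hax hxw huw hwc hwa
    · exact h.adj_conflict huc hca hau hbc hab hux hxa hcx hxb

end Explicit

/-! ### Cyclic triangles, types of vertices, and chains of replacements -/

theorem fin3_11 (i : Fin 3) : i + 1 + 1 = i + 2 := by revert i; decide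
theorem fin3_12 (i : Fin 3) : i + 1 + 2 = i := by revert i; decide
theorem fin3_21 (i : Fin 3) : i + 2 + 1 = i := by revert i; decide
theorem fin3_22 (i : Fin 3) : i + 2 + 2 = i + 1 := by revert i; decide
theorem fin3_cases (i j : Fin 3) : i = j ∨ j = i + 1 ∨ j = i + 2 := by revert i j; decide
theorem fin3_ne1 (i : Fin 3) : i ≠ i + 1 := by revert i; decide
theorem fin3_ne2 (i : Fin 3) : i ≠ i + 2 := by revert i; decide

/-- A cyclic triangle. -/
def IsTri (R : V → V → Prop) (t : Fin 3 → V) : Prop := ∀ i, R (t i) (t (i + 1))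

/-- `w` can take the place of the `i`-th vertex of the cyclic triangle `t`. -/
def Typ (R : V → V → Prop) (w : V) (t : Fin 3 → V) (i : Fin 3) : Prop :=
  R (t (i + 2)) w ∧ R w (t (i + 1))

/-- `w` dominates `t`. -/
def Above (R : V → V → Prop) (w : V) (t : Fin 3 → V) : Prop := ∀ i, R w (t i)

/-- `w` is dominated by `t`. -/
def Below (R : V → V → Prop) (w : V) (t : Fin 3 → V) : Prop := ∀ i, R (t i) w

/-- Two cyclic triangles that agree in two positions. -/
def Step (R : V → V → Prop) (t t' : Fin 3 → V) : Prop :=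
  IsTri R t ∧ IsTri R t' ∧ ∃ i, t (i + 1) = t' (i + 1) ∧ t (i + 2) = t' (i + 2)

/-- A chain of `n` steps. -/
inductive Reach (R : V → V → Prop) : ℕ → (Fin 3 → V) → (Fin 3 → V) → Prop
  | refl (t) : Reach R 0 t t
  | tail {n t s s'} : Reach R n t s → Step R s s' → Reach R (n + 1) t s'

theorem Step.symm {t t' : Fin 3 → V} (h : Step R t t') : Step R t' t :=
  ⟨h.2.1, h.1, h.2.2.imp fun _ hi => ⟨hi.1.symm, hi.2.symm⟩⟩

theorem Reach.trans {m n : ℕ} {t s r : Fin 3 → V} (h : Reach R m t s) (h' : Reach R n s r) :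
    Reach R (m + n) t r := by
  induction h' with
  | refl => exact h
  | tail _ hs ih => exact (ih h).tail hs

theorem Step.reach {t t' : Fin 3 → V} (h : Step R t t') : Reach R 1 t t' := (Reach.refl t).tail h

theorem Reach.symm {n : ℕ} {t s : Fin 3 → V} (h : Reach R n t s) : Reach R n s t := by
  induction h with
  | refl => exact .refl _
  | tail _ hs ih => rw [Nat.add_comm]; exact hs.symm.reach.trans ih

theorem Reach.isTri {n : ℕ} {t s : Fin 3 → V} (h : Reach R n t s) (ht : IsTri R t) :
    IsTri R s := by
  cases h with
  | refl => exact ht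
  | tail _ hs => exact hs.2.1

theorem IsTri.prev {t : Fin 3 → V} (ht : IsTri R t) (i : Fin 3) : R (t (i + 2)) (t i) := by
  simpa only [fin3_21] using ht (i + 2)

theorem IsTri.mid {t : Fin 3 → V} (ht : IsTri R t) (i : Fin 3) :
    R (t (i + 1)) (t (i + 2)) := by
  simpa only [fin3_11] using ht (i + 1)

theorem IsTri.typ {t : Fin 3 → V} (ht : IsTri R t) (i : Fin 3) : Typ R (t i) t i :=
  ⟨ht.prev i, ht i⟩

theorem isTri_iff (t : Fin 3 → V) (i : Fin 3) :
    IsTri R t ↔ R (t i) (t (i + 1)) ∧ R (t (i + 1)) (t (i + 2)) ∧ R (t (i + 2)) (t i) := by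
  refine ⟨fun h => ⟨h i, h.mid i, h.prev i⟩, fun ⟨h0, h1, h2⟩ j => ?_⟩
  rcases fin3_cases i j with rfl | rfl | rfl
  · exact h0
  · rwa [fin3_11]
  · rwa [fin3_21]

theorem typ_add_one {t : Fin 3 → V} {i : Fin 3} {w : V} :
    Typ R w t (i + 1) ↔ R (t i) w ∧ R w (t (i + 2)) := by
  rw [Typ, fin3_12, fin3_11]

theorem typ_add_two {t : Fin 3 → V} {i : Fin 3} {w : V} :
    Typ R w t (i + 2) ↔ R (t (i + 1)) w ∧ R w (t i) := by
  rw [Typ, fin3_22, fin3_21]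

/-- Replacing a vertex of a cyclic triangle. -/
theorem Typ.step {t : Fin 3 → V} {i : Fin 3} {w : V} (ht : IsTri R t) (h : Typ R w t i) :
    Step R t (Function.update t i w) := by
  refine ⟨ht, (isTri_iff _ i).2 ?_, i, ?_, ?_⟩ <;>
  simp only [Function.update_self, Function.update_of_ne (fin3_ne1 i).symm,
    Function.update_of_ne (fin3_ne2 i).symm]
  exact ⟨h.2, ht.mid i, h.1⟩

theorem IsTour.state (h : IsTour R) {t : Fin 3 → V} (ht : IsTri R t) (w : V) :
    (∃ i, Typ R w t i) ∨ Above R w t ∨ Below R w t := by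
  by_cases hw : ∃ i, w = t i
  · obtain ⟨i, rfl⟩ := hw
    exact Or.inl ⟨i, ht.typ i⟩
  · push Not at hw
    have h0 := h.total (hw 0)
    have h1 := h.total (hw 1)
    have h2 := h.total (hw 2)
    simp only [Fin.exists_fin_succ, Typ, Above, Below, Fin.forall_fin_succ]
    simp
    tauto

theorem Typ.not_above (h : IsTour R) {t : Fin 3 → V} {i : Fin 3} {w : V} (hw : Typ R w t i) :
    ¬ Above R w t := fun ha => h.asymm hw.1 (ha _)

theorem Typ.not_below (h : IsTour R) {t : Fin 3 → V} {i : Fin 3} {w : V} (hw : Typ R w t i) :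
    ¬ Below R w t := fun ha => h.asymm hw.2 (ha _)

theorem Above.of_step {t t' : Fin 3 → V} {w : V} (h : IsTour R) (hs : Step R t t')
    (hw : Above R w t) : Above R w t' ∨ ∃ i, Typ R w t' i := by
  rcases h.state hs.2.1 w with h1 | h1 | h1
  · exact Or.inr h1
  · exact Or.inl h1
  · obtain ⟨i, hi, -⟩ := hs.2.2
    exact absurd (hi ▸ hw (i + 1)) (h.asymm (h1 (i + 1)))

theorem fin3_forall {p : Fin 3 → Prop} (i : Fin 3) (h0 : p i) (h1 : p (i + 1)) (h2 : p (i + 2)) :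
    ∀ j, p j := fun j => by rcases fin3_cases i j with rfl | rfl | rfl <;> assumption

/-- A backward edge over a triangle survives a replacement: any other behavior of the new vertex
towards `x` and `w` creates `U₃` or T5. -/
theorem IsLocal.back_step (h : IsLocal R) {t t' : Fin 3 → V} {x w : V} (hs : Step R t t')
    (hx : Below R x t) (hw : Above R w t) (hxw : R x w) : Below R x t' ∧ Above R w t' := by
  obtain ⟨-, ht', i, h1, h2⟩ := hs
  have hb := hx (i + 1)
  have hc := hx (i + 2)
  have hb' := hw (i + 1)
  have hc' := hw (i + 2)
  rw [h1] at hb hb'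
  rw [h2] at hc hc'
  have e1 := ht' i
  have e2 := ht'.mid i
  have e3 := ht'.prev i
  have hnx : t' i ≠ x := by intro he; rw [he] at e1; exact h.asymm e1 hb
  have hnw : t' i ≠ w := by intro he; rw [he] at e3; exact h.asymm e3 hc'
  rcases h.total hnx with ax | ax <;> rcases h.total hnw with aw | aw
  · exact (h.no_below_back e1 e2 e3 ax hb hc hxw aw hb' hc').elim
  · exact ⟨fin3_forall i ax hb hc, fin3_forall i aw hb' hc'⟩
  · exact (h.no_back_path e1 e2 e3 ax aw hxw hb hc hb' hc').elim
  · exact (h.no_above_back e1 e2 e3 aw hb' hc' hxw ax hb hc).elim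

theorem IsLocal.back_reach (h : IsLocal R) {n : ℕ} {t t' : Fin 3 → V} {x w : V}
    (hs : Reach R n t t') (hx : Below R x t) (hw : Above R w t) (hxw : R x w) :
    Below R x t' ∧ Above R w t' := by
  induction hs with
  | refl => exact ⟨hx, hw⟩
  | tail _ hst ih => exact h.back_step hst (ih hx hw).1 (ih hx hw).2 hxw

/-- A vertex of one triangle of a chain cannot point backwards over another triangle. -/
theorem IsLocal.not_back (h : IsLocal R) {n : ℕ} {t t' : Fin 3 → V} {x w : V} {i : Fin 3}
    (hs : Reach R n t t') (hx : Typ R x t' i ∨ Typ R w t' i) (hxt : Below R x t)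
    (hwt : Above R w t) : ¬ R x w := fun hxw => by
  obtain ⟨h1, h2⟩ := h.back_reach hs hxt hwt hxw
  exact hx.elim (fun hx => hx.not_below h.toIsTour h1) (fun hw => hw.not_above h.toIsTour h2)

/-! ### Consistency of types along chains -/

/-- Types are preserved along chains of at most `n` steps. -/
def Consistent (R : V → V → Prop) (n : ℕ) : Prop :=
  ∀ m < n, ∀ t t' w c c', IsTri R t → Reach R m t t' → Typ R w t c → Typ R w t' c' → c = c'

theorem IsLocal.step_consistent (h : IsLocal R) {t t' : Fin 3 → V} {w : V} {c c' : Fin 3}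
    (hs : Step R t t') (hc : Typ R w t c) (hc' : Typ R w t' c') : c = c' := by
  obtain ⟨ht, ht', i, h1, h2⟩ := hs
  have a1 := ht i
  have a2 := ht.mid i
  have a3 := ht.prev i
  have b1 := ht' i
  have b3 := ht'.prev i
  rw [← h1] at b1
  rw [← h2] at b3
  have c1 : ∀ {d}, Typ R w t d → d = i → R (t (i + 2)) w ∧ R w (t (i + 1)) := by
    rintro d hd rfl; exact hd
  have c2 : ∀ {d}, Typ R w t' d → d = i → R (t (i + 2)) w ∧ R w (t (i + 1)) := by
    rintro d hd rfl; rw [h1, h2]; exact hd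
  by_cases hcc : c = c'
  · exact hcc
  exfalso
  rcases fin3_cases i c with rfl | rfl | rfl <;> rcases fin3_cases i c' with rfl | rfl | rfl
  · exact hcc rfl
  · rw [typ_add_one, ← h2] at hc'
    exact h.asymm (c1 hc rfl).1 hc'.2
  · rw [typ_add_two, ← h1] at hc'
    exact h.asymm (c1 hc rfl).2 hc'.1
  · rw [typ_add_one] at hc
    exact h.asymm hc.2 (c2 hc' rfl).1
  · exact hcc rfl
  · rw [typ_add_one] at hc
    rw [typ_add_two, ← h1] at hc'
    exact h.adj_conflict a1 a2 a3 b1 b3 hc.1 hc.2 hc'.1 hc'.2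
  · rw [typ_add_two] at hc
    exact h.asymm hc.1 (c2 hc' rfl).2
  · rw [typ_add_two] at hc
    rw [typ_add_one, ← h2] at hc'
    exact h.adj_conflict b1 a2 b3 a1 a3 hc'.1 hc'.2 hc.1 hc.2
  · exact hcc rfl

/-- The case of chains with one intermediate triangle, which `w` dominates. -/
theorem IsLocal.two_step_consistent (h : IsLocal R) {s : Fin 3 → V} {x u w : V} {i j : Fin 3}
    (hs : IsTri R s) (hw : Above R w s) (hx : Typ R x s i) (hxw : R x w) (hu : Typ R u s j)
    (huw : R u w) : i = j := by
  have key : ∀ {x u : V} {i : Fin 3}, Typ R x s i → R x w → Typ R u s (i + 1) → R u w → False := by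
    intro x u i hx hxw hu huw
    rw [typ_add_one] at hu
    exact h.two_conflict (hs i) (hs.mid i) (hs.prev i) hx.2 hx.1 hu.1 hu.2 (hw _) (hw _) hxw huw
  rcases fin3_cases i j with rfl | rfl | rfl
  · rfl
  · exact (key hx hxw hu huw).elim
  · refine (key hu huw ?_ hxw).elim
    rwa [fin3_21]

/-- The hypotheses are in fact contradictory. The vertex `u` has type `i + 1` at `t`, hence also at
`s`, so `s i → u`. With `z = t (i + 2)` and `z → s i`, both `x u z` and `s i, u, z` are cyclic
triangles, and `w` has different types at them. -/
theorem IsLocal.long_chain_half (h : IsLocal R) {m : ℕ} {t s : Fin 3 → V} {x u w : V}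
    {i j : Fin 3} (IH : Consistent R (m + 1)) (ht : IsTri R t) (hr : Reach R m t s)
    (hi : Typ R w t (i + 1)) (hxi : x = t i)
    (hu2 : R u (t (i + 2))) (hws : Above R w s) (hxs : Above R x s)
    (huj : Typ R u s j) (hxu : R x u) (huw : R u w) : i = j := by
  have hs := hr.isTri ht
  have hut : Typ R u t (i + 1) := by
    rw [typ_add_one, ← hxi]; exact ⟨hxu, hu2⟩
  obtain rfl : i + 1 = j := IH m (Nat.lt_succ_self m) t s u _ _ ht hr hut huj
  have hzx : R (t (i + 2)) x := hxi ▸ ht.prev i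
  -- If `t (i + 2)` has a type at `s`, it is `i + 2`, which gives the edge. It cannot lie below `s`,
  -- since its edge to `x` would point backwards over `s`.
  have hza : R (t (i + 2)) (s i) := by
    rcases h.state hs (t (i + 2)) with ⟨d, hd⟩ | hz | hz
    · obtain rfl := IH m (Nat.lt_succ_self m) t s _ _ _ ht hr (ht.typ (i + 2)) hd
      exact (typ_add_two.1 hd).2
    · exact hz i
    · exact (h.not_back hr.symm (Or.inl (ht.typ (i + 2))) hz hxs hzx).elim
  rw [typ_add_one] at huj hi
  rw [← hxi] at hi
  exact (h.adj_conflict hxu hu2 hzx huj.1 hza hi.1 hi.2 huw (hws i)).elim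

theorem Step.of_typ {t t' : Fin 3 → V} {w : V} (h : IsTour R) (hs : Step R t t')
    (hw : Above R w t) {c : Fin 3} (hc : Typ R w t' c) :
    ∃ i, c = i + 1 ∧ R (t' i) w ∧ t (i + 1) = t' (i + 1) ∧ t (i + 2) = t' (i + 2) := by
  obtain ⟨-, -, i, h1, h2⟩ := hs
  refine ⟨i, ?_, ?_, h1, h2⟩
  · rcases fin3_cases i c with rfl | rfl | rfl
    · exact (h.asymm hc.1 (h2 ▸ hw _)).elim
    · rfl
    · exact (h.asymm (typ_add_two.1 hc).1 (h1 ▸ hw _)).elim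
  · rcases fin3_cases i c with rfl | rfl | rfl
    · exact (h.asymm hc.1 (h2 ▸ hw _)).elim
    · exact (typ_add_one.1 hc).1
    · exact (h.asymm (typ_add_two.1 hc).1 (h1 ▸ hw _)).elim

/-- Chains whose second and second to last triangle are dominated by `w`. -/
theorem IsLocal.above_consistent (h : IsLocal R) {m : ℕ} {t t1 s r : Fin 3 → V} {w : V}
    {c c' : Fin 3} (IH : Consistent R (m + 2)) (h1 : Step R t t1) (h2 : Reach R m t1 s)
    (h3 : Step R s r) (hw1 : Above R w t1) (hws : Above R w s) (hc : Typ R w t c)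
    (hc' : Typ R w r c') : c = c' := by
  obtain ⟨i, rfl, hxw, i1, i2⟩ := Step.of_typ h.toIsTour h1.symm hw1 hc
  obtain ⟨j, rfl, huw, j1, j2⟩ := Step.of_typ h.toIsTour h3 hws hc'
  have ht := h1.1
  have hs := h3.1
  have hr := h3.2.1
  have hx1 : Typ R (t i) t1 i := by rw [Typ, i1, i2]; exact ht.typ i
  have hus : Typ R (r j) s j := by rw [Typ, j1, j2]; exact hr.typ j
  have R1 : Reach R (m + 1) t s := by rw [Nat.add_comm]; exact h1.reach.trans h2
  have R2 : Reach R (m + 1) r t1 := by rw [Nat.add_comm]; exact h3.symm.reach.trans h2.symm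
  -- The shortcuts below have length 2, which is less than `m + 2` only for `m > 0`.
  rcases Nat.eq_zero_or_pos m with rfl | hm
  · cases h2
    rw [h.two_step_consistent hs hw1 hx1 hxw hus huw]
  -- If `t i` has a type at `s`, inserting it there gives a triangle two steps from `r` at which `w`
  -- has type `i + 1`, and induction finishes. It is not below `s` because of its edge to `w`.
  have hxs : (i + 1 = j + 1) ∨ Above R (t i) s := by
    rcases h.state hs (t i) with ⟨d, hd⟩ | hz | hz
    · obtain rfl := IH _ (Nat.lt_succ_self _) t s _ _ _ ht R1 (ht.typ i) hd
      have st := hd.step hs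
      refine Or.inl (IH 2 (by omega) _ _ w _ _ st.2.1 (st.symm.reach.trans h3.reach) ?_ hc')
      rw [typ_add_one, Function.update_self, Function.update_of_ne (fin3_ne2 i).symm]
      exact ⟨hxw, hws _⟩
    · exact Or.inr hz
    · exact (h.not_back R1.symm (Or.inl (ht.typ i)) hz hws hxw).elim
  have hut : (i + 1 = j + 1) ∨ Above R (r j) t1 := by
    rcases h.state h1.2.1 (r j) with ⟨d, hd⟩ | hz | hz
    · obtain rfl := IH _ (Nat.lt_succ_self _) r t1 _ _ _ hr R2 (hr.typ j) hd
      have st := hd.step h1.2.1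
      refine Or.inl (IH 2 (by omega) _ _ w _ _ st.2.1 (st.symm.reach.trans h1.symm.reach)
        ?_ hc).symm
      rw [typ_add_one, Function.update_self, Function.update_of_ne (fin3_ne2 j).symm]
      exact ⟨huw, hw1 _⟩
    · exact Or.inr hz
    · exact (h.not_back R2.symm (Or.inl (hr.typ j)) hz hw1 huw).elim
  rcases hxs with hh | hxs
  · exact hh
  rcases hut with hh | hut
  · exact hh
  have hne : t i ≠ r j := by
    intro he
    rw [← he] at hut
    exact h.asymm (ht.prev i) (i2 ▸ hut (i + 2))
  rcases h.total hne with hxu | hux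
  · rw [h.long_chain_half IH ht R1 hc rfl (i2 ▸ hut _) hws hxs hus hxu huw]
  · rw [h.long_chain_half IH hr R2 hc' rfl (j2 ▸ hxs _) hw1 hut hx1 hux hxw]

theorem fin3_neg1 (i : Fin 3) : -(-i + 1) = i + 2 := by revert i; decide
theorem fin3_neg2 (i : Fin 3) : -(-i + 2) = i + 1 := by revert i; decide
theorem fin3_neg (i : Fin 3) : -(i + 1) + 1 = -i := by revert i; decide

theorem isTri_flip {t : Fin 3 → V} (ht : IsTri R t) : IsTri (_root_.flip R) (fun i => t (-i)) := by
  intro i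
  have := ht (-(i + 1))
  rwa [fin3_neg] at this

/-- Reversing all edges and negating positions turns cyclic triangles into cyclic triangles and
exchanges above with below, so one of the two cases suffices. -/
theorem typ_flip {t : Fin 3 → V} {w : V} {i : Fin 3} (h : Typ R w t i) :
    Typ (_root_.flip R) w (fun i => t (-i)) (-i) := by
  refine ⟨?_, ?_⟩
  · change R w (t (-(-i + 2))); rw [fin3_neg2]; exact h.2
  · change R (t (-(-i + 1))) w; rw [fin3_neg1]; exact h.1

theorem step_flip {t t' : Fin 3 → V} (h : Step R t t') :
    Step (_root_.flip R) (fun i => t (-i)) (fun i => t' (-i)) := by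
  obtain ⟨h0, h1, i, hi, hj⟩ := h
  refine ⟨isTri_flip h0, isTri_flip h1, -i, ?_, ?_⟩
  · change t (-(-i + 1)) = t' (-(-i + 1))
    rwa [fin3_neg1]
  · change t (-(-i + 2)) = t' (-(-i + 2))
    rwa [fin3_neg2]

theorem reach_flip {n : ℕ} {t t' : Fin 3 → V} (h : Reach R n t t') :
    Reach (_root_.flip R) n (fun i => t (-i)) (fun i => t' (-i)) := by
  induction h with
  | refl => exact .refl _
  | tail _ hs ih => exact ih.tail (step_flip hs)

theorem consistent_flip {n : ℕ} (h : Consistent R n) : Consistent (_root_.flip R) n := by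
  intro m hm t t' w c c' ht hr hc hc'
  have := h m hm (fun i => t (-i)) (fun i => t' (-i)) w (-c) (-c') (isTri_flip ht)
    (reach_flip hr) (typ_flip hc) (typ_flip hc')
  exact neg_injective this

theorem above_along (h : IsTour R) {n : ℕ} {t t' : Fin 3 → V} {w : V} (hr : Reach R n t t')
    (hw : Above R w t) :
    Above R w t' ∨ ∃ k l s c, k + l = n ∧ Reach R k t s ∧ Reach R l s t' ∧ Typ R w s c := by
  induction hr with
  | refl => exact Or.inl hw
  | @tail n t s s' hr hs ih =>
    rcases ih hw with ha | ⟨k, l, q, c, rfl, h1, h2, h3⟩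
    · rcases ha.of_step h hs with hb | ⟨c, hc⟩
      · exact Or.inl hb
      · exact Or.inr ⟨n + 1, 0, s', c, rfl, hr.tail hs, .refl _, hc⟩
    · exact Or.inr ⟨k, l + 1, q, c, rfl, h1, h2.tail hs, h3⟩

theorem Reach.head {n : ℕ} {t t' : Fin 3 → V} (h : Reach R (n + 1) t t') :
    ∃ s, Step R t s ∧ Reach R n s t' := by
  have h' := h.symm
  cases h' with
  | tail h1 h2 => exact ⟨_, h2.symm, h1.symm⟩

/-- Induction on the chain length; `Consistent R n` concerns lengths below `n`. If `w` has a type at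
an intermediate triangle, the chain splits there. Otherwise `w` stays above, or stays below, all
intermediate triangles. -/
theorem IsLocal.consistent (h : IsLocal R) (n : ℕ) : Consistent R n := by
  induction n with
  | zero => exact fun m hm => (Nat.not_lt_zero _ hm).elim
  | succ n IH =>
  intro m hm t t' w c c' ht hr hc hc'
  rcases Nat.lt_or_ge m n with hlt | hge
  · exact IH m hlt t t' w c c' ht hr hc hc'
  obtain rfl : m = n := by omega
  rcases m with _ | _ | m
  · cases hr
    by_contra hne
    rcases fin3_cases c c' with rfl | rfl | rfl
    · exact hne rfl
    · exact h.asymm hc.1 (typ_add_one.1 hc').2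
    · exact h.asymm hc.2 (typ_add_two.1 hc').1
  · cases hr with
    | tail h0 hs => cases h0; exact h.step_consistent hs hc hc'
  · obtain ⟨t1, s1, hr'⟩ := hr.head
    cases hr' with
    | @tail _ _ s _ h2 h3 =>
    have mid : ∀ {k l q d}, k + l = m → Reach R k t1 q → Reach R l q s → Typ R w q d → c = c' := by
      intro k l q d hkl hk hl hd
      have e1 := IH (1 + k) (by omega) t q w c d ht (s1.reach.trans hk) hc hd
      have e2 := IH (l + 1) (by omega) q t' w d c' (hk.isTri s1.2.1) (hl.tail h3) hd hc'
      exact e1.trans e2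
    rcases h.state s1.2.1 w with ⟨d, hd⟩ | ha | hb
    · exact mid (Nat.zero_add m) (.refl _) h2 hd
    · rcases above_along h.toIsTour h2 ha with ha' | ⟨k, l, q, d, hkl, hk, hl, hd⟩
      · exact h.above_consistent IH s1 h2 h3 ha ha' hc hc'
      · exact mid hkl hk hl hd
    · have hb1 : Above (_root_.flip R) w (fun i => t1 (-i)) := fun i => hb (-i)
      rcases above_along h.flip.toIsTour (reach_flip h2) hb1 with ha' | ⟨k, l, q, d, hkl, hk, hl, hd⟩
      · exact neg_injective (h.flip.above_consistent (consistent_flip IH) (step_flip s1)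
          (reach_flip h2) (step_flip h3) hb1 ha' (typ_flip hc) (typ_flip hc'))
      · refine mid (q := fun i => q (-i)) hkl ?_ ?_ (typ_flip hd)
        · have := reach_flip hk
          simpa using this
        · have := reach_flip hl
          simpa using this

/-! ### Linked classes and the coloring by positions -/

/-- The linked class of a cyclic triangle. -/
def Linked (R : V → V → Prop) (t t' : Fin 3 → V) : Prop := IsTri R t ∧ ∃ n, Reach R n t t'

theorem Linked.isTri {t t' : Fin 3 → V} (h : Linked R t t') : IsTri R t' :=
  h.2.elim fun _ hn => hn.isTri h.1

theorem Linked.reach {t t' t'' : Fin 3 → V} (h : Linked R t t') (h' : Linked R t t'') :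
    ∃ n, Reach R n t' t'' := by
  obtain ⟨-, n, hn⟩ := h
  obtain ⟨-, m, hm⟩ := h'
  exact ⟨_, hn.symm.trans hm⟩

theorem Linked.step {t t' t'' : Fin 3 → V} (h : Linked R t t') (hs : Step R t' t'') :
    Linked R t t'' := ⟨h.1, h.2.elim fun n hn => ⟨n + 1, hn.tail hs⟩⟩

theorem Linked.update {t t' : Fin 3 → V} (h : Linked R t t') {w : V} {c : Fin 3}
    (hw : Typ R w t' c) : Linked R t (Function.update t' c w) := h.step (hw.step h.isTri)

theorem IsLocal.linked_consistent (h : IsLocal R) {t t1 t2 : Fin 3 → V} {w : V} {c c' : Fin 3}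
    (h1 : Linked R t t1) (h2 : Linked R t t2) (hc : Typ R w t1 c) (hc' : Typ R w t2 c') :
    c = c' := by
  obtain ⟨n, hn⟩ := h1.reach h2
  exact h.consistent (n + 1) n (Nat.lt_succ_self n) _ _ _ _ _ h1.isTri hn hc hc'

theorem IsLocal.linked_above (h : IsLocal R) {t : Fin 3 → V} (ht : IsTri R t) {v : V}
    (hv : ∀ t', Linked R t t' → ∀ c, ¬ Typ R v t' c) (ha : Above R v t) :
    ∀ t', Linked R t t' → Above R v t' := by
  rintro t' ⟨-, n, hn⟩
  rcases above_along h.toIsTour hn ha with h1 | ⟨k, _, s, c, -, hk, -, hs⟩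
  · exact h1
  · exact (hv s ⟨ht, k, hk⟩ c hs).elim

theorem IsLocal.linked_below (h : IsLocal R) {t : Fin 3 → V} (ht : IsTri R t) {v : V}
    (hv : ∀ t', Linked R t t' → ∀ c, ¬ Typ R v t' c) (ha : Below R v t) :
    ∀ t', Linked R t t' → Below R v t' := by
  rintro t' ⟨-, n, hn⟩
  have ha' : Above (_root_.flip R) v (fun i => t (-i)) := fun i => ha (-i)
  rcases above_along h.flip.toIsTour (reach_flip hn) ha' with h1 | ⟨k, _, s, c, -, hk, -, hs⟩
  · intro i
    have : R (t' (- -i)) v := h1 (-i)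
    rwa [neg_neg] at this
  · refine (hv (fun i => s (-i)) ⟨ht, k, ?_⟩ (-c) (typ_flip hs)).elim
    simpa using reach_flip hk

/-- In a prime tournament every linked class of triangles covers all vertices. -/
theorem IsLocal.exists_position (h : IsLocal R) (hp : IsPrime R) {t : Fin 3 → V}
    (ht : IsTri R t) (w : V) : ∃ t' c, Linked R t t' ∧ t' c = w := by
  have htt : Linked R t t := ⟨ht, 0, .refl t⟩
  set M : Set V := {w | ∃ t' c, Linked R t t' ∧ t' c = w} with hM
  -- A vertex outside `M` has no type at any linked triangle, as it could be inserted there; so it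
  -- is above all of them or below all of them.
  have hmod : IsMod R M := by
    rintro v hv u ⟨t1, c1, h1, rfl⟩ u' ⟨t2, c2, h2, rfl⟩ huv hvu
    have hv' : ∀ t', Linked R t t' → ∀ c, ¬ Typ R v t' c := fun t' ht' c hc =>
      hv ⟨_, c, ht'.update hc, Function.update_self ..⟩
    rcases h.state ht v with ⟨i, hi⟩ | ha | hb
    · exact hv' t htt i hi
    · exact h.asymm huv (h.linked_above ht hv' ha t1 h1 c1)
    · exact h.asymm hvu (h.linked_below ht hv' hb t2 h2 c2)
  rcases hp M hmod with hs | hu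
  · have h0 : t 0 = t 1 := hs (show t 0 ∈ M from ⟨t, 0, htt, rfl⟩) (show t 1 ∈ M from ⟨t, 1, htt, rfl⟩)
    have := ht 0
    rw [h0] at this
    exact (h.irrefl (t 1) this).elim
  · have : w ∈ M := hu ▸ Set.mem_univ w
    exact this

/-- A coloring such that the positions of the vertices in a linked class of triangles are their
colors. -/
structure IsPosColoring (R : V → V → Prop) (t : Fin 3 → V) (col : V → Fin 3) : Prop where
  tri : IsTri R t
  pos : ∀ w, ∃ t', Linked R t t' ∧ t' (col w) = w
  typ : ∀ w t' c, Linked R t t' → Typ R w t' c → c = col w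

theorem IsLocal.exists_posColoring (h : IsLocal R) (hp : IsPrime R) {t : Fin 3 → V}
    (ht : IsTri R t) : ∃ col, IsPosColoring R t col := by
  choose f c hf hc using h.exists_position hp ht
  refine ⟨c, ht, fun w => ⟨f w, hf w, hc w⟩, fun w t' d ht' hd => ?_⟩
  refine h.linked_consistent ht' (hf w) hd ?_
  simpa only [hc] using (hf w).isTri.typ (c w)

namespace IsPosColoring

variable {t : Fin 3 → V} {col : V → Fin 3}

theorem state (h : IsLocal R) (hcol : IsPosColoring R t col) {t' : Fin 3 → V}
    (ht' : Linked R t t') (w : V) : Typ R w t' (col w) ∨ Above R w t' ∨ Below R w t' := by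
  refine (h.state ht'.isTri w).imp_left ?_
  rintro ⟨i, hi⟩
  rwa [← hcol.typ w t' i ht' hi]

/-- If `b → a`, then after inserting `b` into `t'` the vertex `a` has type `col b + 1`, which is not
its color. -/
theorem edge_above_typ (hcol : IsPosColoring R t col) {t' : Fin 3 → V}
    (ht' : Linked R t t') {a b : V} (hab : col a = col b) (ha : Above R a t')
    (hb : Typ R b t' (col b)) : ¬ R b a := by
  intro hba
  have := hcol.typ a _ (col b + 1) (ht'.update hb) (by
    rw [typ_add_one, Function.update_self, Function.update_of_ne (fin3_ne2 _).symm]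
    exact ⟨hba, ha _⟩)
  exact fin3_ne1 _ (this.trans hab).symm

theorem edge_typ_below (hcol : IsPosColoring R t col) {t' : Fin 3 → V}
    (ht' : Linked R t t') {a b : V} (hab : col a = col b) (ha : Typ R a t' (col a))
    (hb : Below R b t') : ¬ R b a := by
  intro hba
  have := hcol.typ b _ (col a + 2) (ht'.update ha) (by
    rw [typ_add_two, Function.update_self, Function.update_of_ne (fin3_ne1 _).symm]
    exact ⟨hb _, hba⟩)
  exact fin3_ne2 _ (this.trans hab.symm).symm

/-- A backward edge over `t'` would persist along a chain to a triangle that contains `b`. -/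
theorem edge_above_below (h : IsLocal R) (hcol : IsPosColoring R t col) {t' : Fin 3 → V}
    (ht' : Linked R t t') {a b : V} (ha : Above R a t') (hb : Below R b t') : ¬ R b a := by
  obtain ⟨s, hs, hsb⟩ := hcol.pos b
  obtain ⟨n, hn⟩ := ht'.reach hs
  refine h.not_back (i := col b) hn (Or.inl ?_) hb ha
  simpa only [hsb] using hs.isTri.typ (col b)

/-- Between vertices of one color, edges respect the order above, typed, below with respect to every
linked triangle. -/
theorem above_of_edge (h : IsLocal R) (hcol : IsPosColoring R t col) {t' : Fin 3 → V}
    (ht' : Linked R t t') {a b : V} (hab : col a = col b) (he : R a b) (hb : Above R b t') :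
    Above R a t' := by
  rcases hcol.state h ht' a with ha | ha | ha
  · exact (hcol.edge_above_typ ht' hab.symm hb ha he).elim
  · exact ha
  · exact (hcol.edge_above_below h ht' hb ha he).elim

theorem below_of_edge (h : IsLocal R) (hcol : IsPosColoring R t col) {t' : Fin 3 → V}
    (ht' : Linked R t t') {a b : V} (hab : col a = col b) (he : R a b) (ha : Below R a t') :
    Below R b t' := by
  rcases hcol.state h ht' b with hb | hb | hb
  · exact (hcol.edge_typ_below ht' hab.symm hb ha he).elim
  · exact (hcol.edge_above_below h ht' hb ha he).elim
  · exact hb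

/-- Compare `a` and `b` with a linked triangle through `c`: the edges at `c` and the order of states
force both to be typed. If `c` had another color, its edge to `a` or from `b` would then have the
wrong direction. -/
theorem two_colors (h : IsLocal R) (hcol : IsPosColoring R t col) {a b c : V} (hab : R a b)
    (hbc : R b c) (hca : R c a) (he : col a = col b) : col c = col a := by
  by_contra hne
  obtain ⟨s, hs, hsc⟩ := hcol.pos c
  have hb : ¬ Below R b s := fun hb => h.asymm hbc (hsc ▸ hb (col c))
  have ha : ¬ Above R a s := fun ha => h.asymm hca (hsc ▸ ha (col c))
  rcases hcol.state h hs a with ha' | ha' | ha'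
  · rcases hcol.state h hs b with hb' | hb' | hb'
    · rcases fin3_cases (col a) (col c) with hh | hh | hh
      · exact hne hh.symm
      · have := ha'.2
        rw [← hh, hsc] at this
        exact h.asymm hca this
      · have := hb'.1
        rw [← he, ← hh, hsc] at this
        exact h.asymm hbc this
    · exact ha (hcol.above_of_edge h hs he hab hb')
    · exact hb hb'
  · exact ha ha'
  · exact hb (hcol.below_of_edge h hs he hab ha')

theorem not_monochromatic (h : IsLocal R) (hp : IsPrime R) (hcol : IsPosColoring R t col)
    {a b c : V} (hab : R a b) (hbc : R b c) (hca : R c a) (he : col a = col b)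
    (he' : col b = col c) : False := by
  -- `M` consists of the vertices that have the color of `a` and the same state as `a` at every
  -- linked triangle. Since states are monotone along edges of one color, they are constant on a
  -- monochromatic cyclic triangle, so `M` contains `b`.
  set M : Set V := {v | col a = col v ∧ ∀ s, Linked R t s →
    (Above R a s ↔ Above R v s) ∧ (Below R a s ↔ Below R v s)} with hM
  have hmod : IsMod R M := by
    rintro v hv u ⟨hu, hu'⟩ w ⟨hw, hw'⟩ huv hvw
    obtain ⟨s, hs, hsv⟩ := hcol.pos v
    have hub : ¬ Below R u s := fun hb => h.asymm huv (hsv ▸ hb (col v))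
    have hwa : ¬ Above R w s := fun hb => h.asymm hvw (hsv ▸ hb (col v))
    have hua : ¬ Above R u s := fun ha => hwa ((hw' s hs).1.1 ((hu' s hs).1.2 ha))
    have hwb : ¬ Below R w s := fun hb => hub ((hu' s hs).2.1 ((hw' s hs).2.2 hb))
    -- At a linked triangle through `v`, both `u` and `w` are typed with the color of `a`; another
    -- color of `v` would reverse `v → w` or `u → v`.
    have hcv : col a = col v := by
      have hu3 : Typ R u s (col u) := (hcol.state h hs u).resolve_right (by tauto)
      have hw3 : Typ R w s (col w) := (hcol.state h hs w).resolve_right (by tauto)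
      rcases fin3_cases (col a) (col v) with hh | hh | hh
      · exact hh
      · have := hw3.2
        rw [← hw, ← hh, hsv] at this
        exact (h.asymm hvw this).elim
      · have := hu3.1
        rw [← hu, ← hh, hsv] at this
        exact (h.asymm huv this).elim
    refine hv ⟨hcv, fun s hs => ?_⟩
    have i1 := hcol.above_of_edge h hs (hu.symm.trans hcv) huv
    have i2 := hcol.below_of_edge h hs (hu.symm.trans hcv) huv
    have i3 := hcol.above_of_edge h hs (hcv.symm.trans hw) hvw
    have i4 := hcol.below_of_edge h hs (hcv.symm.trans hw) hvw
    obtain ⟨j1, j2⟩ := hu' s hs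
    obtain ⟨j3, j4⟩ := hw' s hs
    exact ⟨⟨fun ha => i3 (j3.1 ha), fun hv => j1.2 (i1 hv)⟩,
      ⟨fun hb => i2 (j2.1 hb), fun hv => j4.2 (i4 hv)⟩⟩
  have hbM : b ∈ M := by
    refine ⟨he, fun s hs => ?_⟩
    have i1 := hcol.above_of_edge h hs he hab
    have i2 := hcol.below_of_edge h hs he hab
    have i3 := hcol.above_of_edge h hs he' hbc
    have i4 := hcol.below_of_edge h hs he' hbc
    have i5 := hcol.above_of_edge h hs (he.trans he').symm hca
    have i6 := hcol.below_of_edge h hs (he.trans he').symm hca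
    exact ⟨⟨fun ha => i3 (i5 ha), i1⟩, ⟨i2, fun hb => i6 (i4 hb)⟩⟩
  rcases hp M hmod with hs | hu
  · have h0 : a = b := hs (show a ∈ M from ⟨rfl, fun _ _ => ⟨Iff.rfl, Iff.rfl⟩⟩) hbM
    rw [h0] at hab
    exact h.irrefl b hab
  · have key : ∀ i, col a = i := by
      intro i
      have h1 : t i ∈ M := hu ▸ Set.mem_univ _
      rw [h1.1]
      exact (hcol.typ (t i) t i ⟨hcol.tri, 0, .refl t⟩ (hcol.tri.typ i)).symm
    exact absurd ((key 0).symm.trans (key 1)) (by decide)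

theorem rainbow (h : IsLocal R) (hp : IsPrime R) (hcol : IsPosColoring R t col) {a b c : V}
    (hab : R a b) (hbc : R b c) (hca : R c a) : col a ≠ col b := fun he =>
  hcol.not_monochromatic h hp hab hbc hca he
    (he.symm.trans (hcol.two_colors h hab hbc hca he).symm)

end IsPosColoring

/-- In a prime tournament without copies of `U₃` and of the regular five-vertex tournament, there
is a 3-coloring in which the vertices of any cyclic triangle have different colors. -/
theorem IsLocal.exists_rainbow (h : IsLocal R) (hp : IsPrime R) :
    ∃ col : V → Fin 3, ∀ a b c, R a b → R b c → R c a → col a ≠ col b := by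
  by_cases ht : ∃ t, IsTri R t
  · obtain ⟨t, ht⟩ := ht
    obtain ⟨col, hcol⟩ := h.exists_posColoring hp ht
    exact ⟨col, fun a b c => hcol.rainbow h hp⟩
  · refine ⟨fun _ => 0, fun a b c hab hbc hca => (ht ⟨![a, b, c], ?_⟩).elim⟩
    rw [isTri_iff _ 0]
    exact ⟨hab, hbc, hca⟩


/-! ### Regular five-vertex tournaments and local transitivity -/

/-- A regular tournament on five vertices. -/
def IsT5 (R : V → V → Prop) (F : Fin 5 → V) : Prop := ∀ i, R (F i) (F (i + 1)) ∧ R (F i) (F (i + 2))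

/-- `w` can take the place of the `k`-th vertex of `F`. -/
def Typ5 (R : V → V → Prop) (w : V) (F : Fin 5 → V) (k : Fin 5) : Prop :=
  R w (F (k + 1)) ∧ R w (F (k + 2)) ∧ R (F (k + 3)) w ∧ R (F (k + 4)) w

/-- Two regular tournaments on five vertices that agree in four positions. -/
def Step5 (R : V → V → Prop) (F F' : Fin 5 → V) : Prop :=
  IsT5 R F ∧ IsT5 R F' ∧ ∃ i, ∀ j, j ≠ i → F j = F' j

theorem fin5_cases (i j : Fin 5) : j = i ∨ j = i + 1 ∨ j = i + 2 ∨ j = i + 3 ∨ j = i + 4 := by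
  revert i j; decide

theorem fin5_ne (i d : Fin 5) (hd : d ≠ 0) : i + d ≠ i := by revert i d; decide

theorem fin5_add_ne (k : Fin 5) {d e : Fin 5} (h : d ≠ e) : k + d ≠ k + e := fun he =>
  h (add_left_cancel he)

theorem fin5_add_two_three (k : Fin 5) : k = k + 2 + 3 := by revert k; decide

theorem fin5_add_four_one (k : Fin 5) : k + 4 + 1 = k := by revert k; decide

theorem fin3_lt_cases {d e : Fin 3} (h : ¬ d ≤ e) :
    d = 1 ∧ e = 0 ∨ d = 2 ∧ e = 1 ∨ d = 2 ∧ e = 0 := by revert d e; decide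

/-- For `exists_cover`: unprimed means lying in the chosen set, primed means lying in `H`. At most
one vertex of a cyclic triangle lies in `H`, which leaves four cases. -/
theorem no_triple {A B C A' B' C' : Prop} (ha : A ∨ A') (hb : B ∨ B') (hc : C ∨ C')
    (m1 : A' → B' → False) (m2 : B' → C' → False) (m3 : C' → A' → False)
    (n0 : A → B → C → False) (n1 : A' → B → C → False) (n2 : B' → C → A → False)
    (n3 : C' → A → B → False) : False := by tauto

theorem fin5_forall {p : Fin 5 → Prop} (i : Fin 5) (h0 : p i) (h1 : p (i + 1)) (h2 : p (i + 2))
    (h3 : p (i + 3)) (h4 : p (i + 4)) : ∀ j, p j := fun j => by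
  rcases fin5_cases i j with rfl | rfl | rfl | rfl | rfl <;> assumption

theorem Step5.symm {F F' : Fin 5 → V} (h : Step5 R F F') : Step5 R F' F :=
  ⟨h.2.1, h.1, h.2.2.imp fun _ hi j hj => (hi j hj).symm⟩

theorem IsT5.edges {F : Fin 5 → V} (hF : IsT5 R F) (i : Fin 5) :
    (R (F i) (F (i + 1)) ∧ R (F (i + 1)) (F (i + 2)) ∧ R (F (i + 2)) (F (i + 3)) ∧
      R (F (i + 3)) (F (i + 4)) ∧ R (F (i + 4)) (F i)) ∧
    (R (F i) (F (i + 2)) ∧ R (F (i + 1)) (F (i + 3)) ∧ R (F (i + 2)) (F (i + 4)) ∧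
      R (F (i + 3)) (F i) ∧ R (F (i + 4)) (F (i + 1))) := by
  have h0 := hF i
  have h1 := hF (i + 1)
  have h2 := hF (i + 2)
  have h3 := hF (i + 3)
  have h4 := hF (i + 4)
  simp only [add_assoc, Fin.reduceAdd, add_zero] at h0 h1 h2 h3 h4
  exact ⟨⟨h0.1, h1.1, h2.1, h3.1, h4.1⟩, h0.2, h1.2, h2.2, h3.2, h4.2⟩

theorem IsT5.typ {F : Fin 5 → V} (hF : IsT5 R F) (i : Fin 5) : Typ5 R (F i) F i := by
  obtain ⟨h1, h2⟩ := hF.edges i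
  exact ⟨h1.1, h2.1, h2.2.2.2.1, h1.2.2.2.2⟩

theorem isT5_of_edges {F : Fin 5 → V} (i : Fin 5)
    (h : (R (F i) (F (i + 1)) ∧ R (F (i + 1)) (F (i + 2)) ∧ R (F (i + 2)) (F (i + 3)) ∧
      R (F (i + 3)) (F (i + 4)) ∧ R (F (i + 4)) (F i)) ∧
    (R (F i) (F (i + 2)) ∧ R (F (i + 1)) (F (i + 3)) ∧ R (F (i + 2)) (F (i + 4)) ∧
      R (F (i + 3)) (F i) ∧ R (F (i + 4)) (F (i + 1)))) : IsT5 R F := by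
  obtain ⟨⟨h1, h2, h3, h4, h5⟩, h6, h7, h8, h9, h10⟩ := h
  refine fin5_forall i ?_ ?_ ?_ ?_ ?_ <;> (try simp only [add_assoc, Fin.reduceAdd, add_zero]) <;>
  constructor <;> assumption

theorem Typ5.step {F : Fin 5 → V} {k : Fin 5} {w : V} (hF : IsT5 R F) (h : Typ5 R w F k) :
    Step5 R F (Function.update F k w) := by
  refine ⟨hF, isT5_of_edges k ?_, k, fun j hj => (Function.update_of_ne hj ..).symm⟩
  simp only [Function.update_self, Function.update_of_ne (fin5_ne k 1 (by decide)),
    Function.update_of_ne (fin5_ne k 2 (by decide)),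
    Function.update_of_ne (fin5_ne k 3 (by decide)),
    Function.update_of_ne (fin5_ne k 4 (by decide))]
  obtain ⟨h1, h2⟩ := hF.edges k
  obtain ⟨h3, h4, h5, h6⟩ := h
  exact ⟨⟨h3, h1.2.1, h1.2.2.1, h1.2.2.2.1, h6⟩, h4, h2.2.1, h2.2.2.1, h5, h2.2.2.2.2⟩

theorem Typ5.unique (h : IsTour R) {F : Fin 5 → V} {k k' : Fin 5} {w : V} (hk : Typ5 R w F k)
    (hk' : Typ5 R w F k') : k' = k := by
  obtain ⟨h1, h2, h3, h4⟩ := hk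
  obtain ⟨h1', h2', h3', h4'⟩ := hk'
  rcases fin5_cases k k' with rfl | rfl | rfl | rfl | rfl
  · rfl
  all_goals simp only [add_assoc, Fin.reduceAdd, add_zero] at h1' h2' h3' h4'
  · exact (h.asymm h3 h2').elim
  · exact (h.asymm h3 h1').elim
  · exact (h.asymm h4 h1').elim
  · exact (h.asymm h2 h3').elim

/-- The possible adjacencies of a vertex to a regular tournament on five vertices. -/
theorem typ5_of_change (h : IsTour R) (hU : NoU R) {F : Fin 5 → V} (hF : IsT5 R F) {w : V}
    {k : Fin 5} (h2 : R w (F (k + 2))) (h3 : R (F (k + 3)) w) : Typ5 R w F k := by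
  obtain ⟨⟨e01, e12, e23, e34, e40⟩, e02, e13, e24, e30, e41⟩ := hF.edges k
  by_cases hw : w = F k
  · rw [hw]; exact hF.typ k
  have hw1 : w ≠ F (k + 1) := by rintro rfl; exact h.asymm h3 e13
  have hw4 : w ≠ F (k + 4) := by rintro rfl; exact h.asymm h2 e24
  rcases h.total hw with h0 | h0 <;> rcases h.total hw1 with h1 | h1 <;>
  rcases h.total hw4 with h4 | h4
  · exact (hU (F (k + 3)) w (F (k + 2)) (F (k + 4)) (F (k + 1)) (by assumption) (by assumption) (by assumption) (by assumption)
      (by assumption) (by assumption) (by assumption) (by assumption) (by assumption) (by assumption)).elim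
  · exact ⟨h1, h2, h3, h4⟩
  · exact (hU (F k) (F (k + 1)) w (F (k + 2)) (F (k + 3)) (by assumption) (by assumption) (by assumption) (by assumption)
      (by assumption) (by assumption) (by assumption) (by assumption) (by assumption) (by assumption)).elim
  · exact (hU (F k) (F (k + 1)) w (F (k + 2)) (F (k + 3)) (by assumption) (by assumption) (by assumption) (by assumption)
      (by assumption) (by assumption) (by assumption) (by assumption) (by assumption) (by assumption)).elim
  · exact (hU (F (k + 3)) w (F (k + 2)) (F (k + 4)) (F (k + 1)) (by assumption) (by assumption) (by assumption) (by assumption)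
      (by assumption) (by assumption) (by assumption) (by assumption) (by assumption) (by assumption)).elim
  · exact ⟨h1, h2, h3, h4⟩
  · exact (hU (F (k + 1)) (F (k + 3)) (F k) w (F (k + 4)) (by assumption) (by assumption) (by assumption) (by assumption)
      (by assumption) (by assumption) (by assumption) (by assumption) (by assumption) (by assumption)).elim
  · exact (hU (F (k + 4)) (F (k + 1)) (F (k + 3)) w (F (k + 2)) (by assumption) (by assumption) (by assumption) (by assumption)
      (by assumption) (by assumption) (by assumption) (by assumption) (by assumption) (by assumption)).elim

/-- A vertex dominates `F`, is dominated by `F`, or can replace a vertex of `F`. -/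
theorem state5 (h : IsTour R) (hU : NoU R) {F : Fin 5 → V} (hF : IsT5 R F) (w : V) :
    (∃ k, Typ5 R w F k) ∨ (∀ i, R w (F i)) ∨ ∀ i, R (F i) w := by
  by_cases hw : ∃ i, w = F i
  · obtain ⟨i, rfl⟩ := hw
    exact Or.inl ⟨i, hF.typ i⟩
  push Not at hw
  by_cases hk : ∃ k, R w (F (k + 2)) ∧ R (F (k + 3)) w
  · obtain ⟨k, hk2, hk3⟩ := hk
    exact Or.inl ⟨k, typ5_of_change h hU hF hk2 hk3⟩
  push Not at hk
  have next : ∀ i, R w (F i) → R w (F (i + 1)) := by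
    intro i hi
    have := hk (i + 3)
    simp only [add_assoc, Fin.reduceAdd, add_zero] at this
    exact h.of_not (hw _).symm (this hi)
  right
  by_cases h0 : ∃ i, R w (F i)
  · obtain ⟨i, h0⟩ := h0
    have h1 := next _ h0
    have h2 := next _ h1
    have h3 := next _ h2
    have h4 := next _ h3
    simp only [add_assoc, Fin.reduceAdd] at h2 h3 h4
    exact Or.inl (fin5_forall i h0 h1 h2 h3 h4)
  · push Not at h0
    exact Or.inr fun i => h.of_not (hw i) (h0 i)

/-- Linked regular tournaments on five vertices. -/
def Linked5 (R : V → V → Prop) (F F' : Fin 5 → V) : Prop :=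
  IsT5 R F ∧ Relation.ReflTransGen (Step5 R) F F'

theorem Linked5.isT5 {F F' : Fin 5 → V} (h : Linked5 R F F') : IsT5 R F' := by
  obtain ⟨h0, h1⟩ := h
  cases h1 with
  | refl => exact h0
  | tail _ hs => exact hs.2.1

theorem Linked5.update {F F' : Fin 5 → V} (h : Linked5 R F F') {w : V} {k : Fin 5}
    (hw : Typ5 R w F' k) : Linked5 R F (Function.update F' k w) :=
  ⟨h.1, h.2.tail (hw.step h.isT5)⟩

theorem Linked5.reverse {F F' : Fin 5 → V} (h : Relation.ReflTransGen (Step5 R) F F') :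
    Relation.ReflTransGen (Step5 R) F' F := by
  induction h with
  | refl => exact .refl
  | tail _ hs ih => exact .head hs.symm ih

theorem Linked5.trans {F F' F'' : Fin 5 → V} (h : Linked5 R F F') (h' : Linked5 R F F'') :
    Linked5 R F' F'' :=
  ⟨h.isT5, (Linked5.reverse h.2).trans h'.2⟩

theorem Linked5.symm {F F' : Fin 5 → V} (h : Linked5 R F F') : Linked5 R F' F :=
  h.trans ⟨h.1, .refl⟩

/-- A typed vertex has two in-neighbors in `F'`, and a step changes only one vertex, so domination
cannot be lost. Triangles lack this rigidity, which is why chain lengths play no role here. -/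
theorem Linked5.above (h : IsTour R) (hU : NoU R) {F F' : Fin 5 → V} {w : V}
    (hl : Linked5 R F F') (hw : ∀ i, R w (F i)) : ∀ i, R w (F' i) := by
  induction hl.2 with
  | refl => exact hw
  | @tail G G' h1 hs ih =>
    have ih := ih ⟨hl.1, h1⟩
    obtain ⟨-, hG', i, hi⟩ := hs
    rcases state5 h hU hG' w with ⟨k, hk⟩ | ha | hb
    · by_cases hki : k + 3 = i
      · refine (h.asymm hk.2.2.2 ?_).elim
        rw [← hi (k + 4) (by rw [← hki]; exact fin5_add_ne k (by decide))]
        exact ih _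
      · refine (h.asymm hk.2.2.1 ?_).elim
        rw [← hi (k + 3) hki]
        exact ih _
    · exact ha
    · refine (h.asymm (hb (i + 1)) ?_).elim
      rw [← hi (i + 1) (fin5_ne i 1 (by decide))]
      exact ih _

theorem Linked5.below (h : IsTour R) (hU : NoU R) {F F' : Fin 5 → V} {w : V}
    (hl : Linked5 R F F') (hw : ∀ i, R (F i) w) : ∀ i, R (F' i) w := by
  induction hl.2 with
  | refl => exact hw
  | @tail G G' h1 hs ih =>
    have ih := ih ⟨hl.1, h1⟩
    obtain ⟨-, hG', i, hi⟩ := hs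
    rcases state5 h hU hG' w with ⟨k, hk⟩ | ha | hb
    · by_cases hki : k + 1 = i
      · refine (h.asymm hk.2.1 ?_).elim
        rw [← hi (k + 2) (by rw [← hki]; exact fin5_add_ne k (by decide))]
        exact ih _
      · refine (h.asymm hk.1 ?_).elim
        rw [← hi (k + 1) hki]
        exact ih _
    · refine (h.asymm (ha (i + 1)) ?_).elim
      rw [← hi (i + 1) (fin5_ne i 1 (by decide))]
      exact ih _
    · exact hb

theorem exists_position5 (h : IsTour R) (hU : NoU R) (hp : IsPrime R) {F : Fin 5 → V}
    (hF : IsT5 R F) (w : V) : ∃ F' k, Linked5 R F F' ∧ F' k = w := by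
  have hFF : Linked5 R F F := ⟨hF, .refl⟩
  set M : Set V := {w | ∃ F' k, Linked5 R F F' ∧ F' k = w} with hM
  have hmod : IsMod R M := by
    rintro v hv u ⟨F1, k1, h1, rfl⟩ u' ⟨F2, k2, h2, rfl⟩ huv hvu
    rcases state5 h hU hF v with ⟨i, hi⟩ | ha | hb
    · exact hv ⟨_, i, hFF.update hi, Function.update_self ..⟩
    · exact h.asymm huv (h1.above h hU ha k1)
    · exact h.asymm hvu (h2.below h hU hb k2)
  rcases hp M hmod with hs | hu
  · have h0 : F 0 = F 1 :=
      hs (show F 0 ∈ M from ⟨F, 0, hFF, rfl⟩) (show F 1 ∈ M from ⟨F, 1, hFF, rfl⟩)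
    have := (hF 0).1
    rw [h0] at this
    exact (h.irrefl (F 1) this).elim
  · have : w ∈ M := hu ▸ Set.mem_univ w
    exact this

/-- If `w` were above or below `F`, it would be so for a linked copy that contains `w`. -/
theorem exists_typ5 (h : IsTour R) (hU : NoU R) (hp : IsPrime R) {F : Fin 5 → V}
    (hF : IsT5 R F) (w : V) : ∃ k, Typ5 R w F k := by
  obtain ⟨F', k, hl, rfl⟩ := exists_position5 h hU hp hF w
  rcases state5 h hU hF (F' k) with h1 | ha | hb
  · exact h1
  · exact (h.irrefl _ (hl.above h hU ha k)).elim
  · exact (h.irrefl _ (hl.below h hU hb k)).elim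

/-- The type of `w` from four of its adjacencies. -/
theorem typ5_cases (h : IsTour R) (hU : NoU R) (hp : IsPrime R) {F : Fin 5 → V}
    (hF : IsT5 R F) (w : V) (k : Fin 5) : Typ5 R w F k ∨ Typ5 R w F (k + 1) ∨
      Typ5 R w F (k + 2) ∨ Typ5 R w F (k + 3) ∨ Typ5 R w F (k + 4) := by
  obtain ⟨j, hj⟩ := exists_typ5 h hU hp hF w
  rcases fin5_cases k j with rfl | rfl | rfl | rfl | rfl <;> tauto

/-- How the type of a vertex changes when one vertex of `F` is replaced. -/
theorem Step5.typ (h : IsTour R) (hU : NoU R) (hp : IsPrime R) {F F' : Fin 5 → V}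
    (hF' : IsT5 R F') {i : Fin 5} (hi : ∀ j, j ≠ i → F j = F' j) {w : V} {k : Fin 5}
    (hw : Typ5 R w F k) :
    (i ≠ k + 2 → i ≠ k + 3 → Typ5 R w F' k) ∧
    (i = k + 2 → Typ5 R w F' k ∧ R w (F' (k + 2)) ∨ Typ5 R w F' (k + 4) ∧ R (F' (k + 2)) w) ∧
    (i = k + 3 → Typ5 R w F' k ∧ R (F' (k + 3)) w ∨ Typ5 R w F' (k + 1) ∧ R w (F' (k + 3))) := by
  obtain ⟨h1, h2, h3, h4⟩ := hw
  have hc := typ5_cases h hU hp hF' w k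
  simp only [Typ5, add_assoc, Fin.reduceAdd, add_zero] at hc ⊢
  refine ⟨fun n2 n3 => ?_, ?_, ?_⟩
  · rw [hi _ n2.symm] at h2
    rw [hi _ n3.symm] at h3
    have := typ5_of_change h hU hF' h2 h3
    simpa only [Typ5] using this
  · rintro rfl
    rw [hi (k + 1) (fin5_add_ne k (by decide))] at h1
    rw [hi (k + 3) (fin5_add_ne k (by decide))] at h3
    rw [hi (k + 4) (fin5_add_ne k (by decide))] at h4
    rcases hc with hc | hc | hc | hc | hc
    · exact Or.inl ⟨hc, hc.2.1⟩
    · exact (h.asymm h3 hc.2.1).elim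
    · exact (h.asymm h3 hc.1).elim
    · exact (h.asymm h4 hc.1).elim
    · exact Or.inr ⟨hc, hc.2.2.1⟩
  · rintro rfl
    rw [hi (k + 1) (fin5_add_ne k (by decide))] at h1
    rw [hi (k + 2) (fin5_add_ne k (by decide))] at h2
    rw [hi (k + 4) (fin5_add_ne k (by decide))] at h4
    rcases hc with hc | hc | hc | hc | hc
    · exact Or.inl ⟨hc, hc.2.2.1⟩
    · exact Or.inr ⟨hc, hc.2.1⟩
    · exact (h.asymm h4 hc.2.1).elim
    · exact (h.asymm h4 hc.1).elim
    · exact (h.asymm h2 hc.2.2.1).elim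

theorem Typ5.update_typ (h : IsTour R) (hU : NoU R) (hp : IsPrime R) {F : Fin 5 → V}
    (hF : IsT5 R F) {i : Fin 5} {u : V} (hu : Typ5 R u F i) {w : V} {k : Fin 5}
    (hw : Typ5 R w F k) :
    (i = k + 2 → Typ5 R w (Function.update F i u) k ∧ R w u ∨
      Typ5 R w (Function.update F i u) (k + 4) ∧ R u w) ∧
    (i = k + 3 → Typ5 R w (Function.update F i u) k ∧ R u w ∨
      Typ5 R w (Function.update F i u) (k + 1) ∧ R w u) := by
  obtain ⟨-, h2, h3⟩ := Step5.typ h hU hp (hu.step hF).2.1 (i := i)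
    (fun j hj => (Function.update_of_ne hj ..).symm) hw
  constructor
  · rintro rfl
    simpa only [Function.update_self] using h2 rfl
  · rintro rfl
    simpa only [Function.update_self] using h3 rfl

/-- Replacing `F k` by `u` does not affect the type `k + 1` of `v`, so the new vertex at position
`k` dominates `v`. -/
theorem Typ5.edge_succ (h : IsTour R) (hU : NoU R) (hp : IsPrime R) {F : Fin 5 → V}
    (hF : IsT5 R F) {u v : V} {k : Fin 5} (hu : Typ5 R u F k) (hv : Typ5 R v F (k + 1)) :
    R u v := by
  have hne : u ≠ v := by
    rintro rfl
    exact fin5_ne k 1 (by decide) (hu.unique h hv)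
  have hF' := (hu.step hF).2.1
  have := (Step5.typ h hU hp hF' (i := k)
    (fun j hj => (Function.update_of_ne hj ..).symm) hv).1
    (by rw [add_assoc]; exact (fin5_ne k 3 (by decide)).symm)
    (by rw [add_assoc]; exact (fin5_ne k 4 (by decide)).symm)
  have := this.2.2.2
  simp only [add_assoc, Fin.reduceAdd, add_zero, Function.update_self] at this
  exact this

/-- Inserting `v` at `k + 2` shifts the type of `u` to `k + 4`, and inserting `u` at `k` shifts that
of `v` to `k + 3`; the shifted types contain the two edges. -/
theorem Typ5.edge_back (h : IsTour R) (hU : NoU R) (hp : IsPrime R) {F : Fin 5 → V}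
    (hF : IsT5 R F) {u v : V} {k : Fin 5} (hu : Typ5 R u F k) (hv : Typ5 R v F (k + 2))
    (hvu : R v u) : R u (F k) ∧ R (F (k + 2)) v := by
  constructor
  · rcases (hv.update_typ h hU hp hF hu).1 rfl with h1 | h1
    · exact (h.asymm h1.2 hvu).elim
    · have := h1.1.1
      simp only [add_assoc, Fin.reduceAdd, add_zero] at this
      rwa [Function.update_of_ne (fin5_ne k 2 (by decide)).symm] at this
  · rcases (hu.update_typ h hU hp hF hv).2 (fin5_add_two_three k) with h1 | h1
    · exact (h.asymm h1.2 hvu).elim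
    · have := h1.1.2.2.2
      simp only [add_assoc, Fin.reduceAdd] at this
      rwa [Function.update_of_ne (fin5_ne k 2 (by decide))] at this

/-- A cyclic triangle whose vertices have the same type keeps this property. -/
theorem Step5.same_typ (h : IsTour R) (hU : NoU R) (hp : IsPrime R) {F F' : Fin 5 → V}
    (hs : Step5 R F F') {a b c : V} (hab : R a b) (hbc : R b c) (hca : R c a)
    (hk : ∃ k, Typ5 R a F k ∧ Typ5 R b F k ∧ Typ5 R c F k) :
    ∃ k, Typ5 R a F' k ∧ Typ5 R b F' k ∧ Typ5 R c F' k := by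
  obtain ⟨k, ha, hb, hc⟩ := hk
  obtain ⟨-, hF', i, hi⟩ := hs
  -- All edges go from type `j` to type `j + 1`, so a cyclic triangle cannot be split between them.
  have hj : ∃ j, ∀ w, Typ5 R w F k → Typ5 R w F' j ∨ Typ5 R w F' (j + 1) := by
    by_cases h2 : i = k + 2
    · refine ⟨k + 4, fun w hw => ?_⟩
      rw [fin5_add_four_one]
      have := (Step5.typ h hU hp hF' hi hw).2.1 h2
      tauto
    · refine ⟨k, fun w hw => ?_⟩
      by_cases h3 : i = k + 3
      · have := (Step5.typ h hU hp hF' hi hw).2.2 h3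
        tauto
      · exact Or.inl ((Step5.typ h hU hp hF' hi hw).1 h2 h3)
  obtain ⟨j, hj⟩ := hj
  have back : ∀ {u v : V}, R u v → Typ5 R v F' j → ¬ Typ5 R u F' (j + 1) := fun huv hv hu =>
    h.asymm huv (hv.edge_succ h hU hp hF' hu)
  have b1 := back hab
  have b2 := back hbc
  have b3 := back hca
  have j1 := hj a ha
  have j2 := hj b hb
  have j3 := hj c hc
  by_cases hja : Typ5 R a F' j
  · exact ⟨j, by tauto⟩
  · exact ⟨j + 1, by tauto⟩

theorem not_same_typ (h : IsTour R) (hU : NoU R) (hp : IsPrime R) {F : Fin 5 → V}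
    (hF : IsT5 R F) {a b c : V} {k : Fin 5} (hab : R a b) (hbc : R b c) (hca : R c a)
    (ha : Typ5 R a F k) (hb : Typ5 R b F k) (hc : Typ5 R c F k) : False := by
  have hall : ∀ F', Linked5 R F F' → ∃ k, Typ5 R a F' k ∧ Typ5 R b F' k ∧ Typ5 R c F' k := by
    rintro F' ⟨-, hl⟩
    induction hl with
    | refl => exact ⟨k, ha, hb, hc⟩
    | tail _ hs ih => exact hs.same_typ h hU hp hab hbc hca ih
  -- The vertices that share the type of `a` at every linked copy. They form a module containing `a`
  -- and `b`, but not all of `F`.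
  set M : Set V := {v | ∀ F', Linked5 R F F' → ∀ k, Typ5 R a F' k → Typ5 R v F' k} with hM
  have haM : a ∈ M := fun F' _ k hk => hk
  have hbM : b ∈ M := by
    intro F' hl k hk
    obtain ⟨j, h1, h2, -⟩ := hall F' hl
    rwa [h1.unique h hk]
  have hmod : IsMod R M := by
    intro v hv u hu u' hu' huv hvu
    refine hv fun F' hl j hj => ?_
    have hF' := hl.isT5
    have hju := hu F' hl j hj
    have hju' := hu' F' hl j hj
    rcases typ5_cases h hU hp hF' v j with hv | hv | hv | hv | hv
    · exact hv
    · exact (h.asymm hvu (hju'.edge_succ h hU hp hF' hv)).elim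
    · rcases (hv.update_typ h hU hp hF' hj).1 rfl with h1 | h1
      · have := (hu' _ (hl.update hv) _ h1.1).2.1
        rw [Function.update_self] at this
        exact (h.asymm hvu this).elim
      · have := (hu _ (hl.update hv) _ h1.1).2.2.1
        simp only [add_assoc, Fin.reduceAdd, Function.update_self] at this
        exact (h.asymm huv this).elim
    · rcases (hv.update_typ h hU hp hF' hj).2 rfl with h1 | h1
      · have := (hu _ (hl.update hv) _ h1.1).2.2.1
        rw [Function.update_self] at this
        exact (h.asymm huv this).elim
      · have := (hu' _ (hl.update hv) _ h1.1).2.1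
        simp only [add_assoc, Fin.reduceAdd, Function.update_self] at this
        exact (h.asymm hvu this).elim
    · have e := fin5_add_four_one j
      exact (h.asymm huv (hv.edge_succ h hU hp hF' (e.symm ▸ hju))).elim
  rcases hp M hmod with hs | hu
  · rw [hs haM hbM] at hab
    exact h.irrefl b hab
  · have key : ∀ i, k = i := by
      intro i
      have h1 : F i ∈ M := hu ▸ Set.mem_univ _
      exact (hF.typ i).unique h (h1 F ⟨hF, .refl⟩ k ha)
    exact absurd ((key 0).symm.trans (key 1)) (by decide)

/-- A relation that respects a three-valued rank has no cyclic triangle with nonconstant rank. -/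
theorem rank_const {p : V → Fin 3 → Prop} {a b c : V} (hab : R a b) (hbc : R b c) (hca : R c a)
    (ha : ∃ d, p a d) (hb : ∃ d, p b d) (hc : ∃ d, p c d)
    (hr : ∀ u v d e, (u = a ∨ u = b ∨ u = c) → (v = a ∨ v = b ∨ v = c) → R u v → p u d → p v e →
      d ≤ e) : ∃ d, p a d ∧ p b d ∧ p c d := by
  obtain ⟨i, hi⟩ := ha
  obtain ⟨j, hj⟩ := hb
  obtain ⟨l, hl⟩ := hc
  have h1 := hr a b i j (by simp) (by simp) hab hi hj
  have h2 := hr b c j l (by simp) (by simp) hbc hj hl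
  have h3 := hr c a l i (by simp) (by simp) hca hl hi
  obtain rfl : i = j := le_antisymm h1 (h2.trans h3)
  obtain rfl : i = l := le_antisymm h2 h3
  exact ⟨i, hi, hj, hl⟩

/-- The tournament is locally transitive if it contains the regular tournament `F`. -/
theorem out_transitive (h : IsTour R) (hU : NoU R) (hp : IsPrime R) {F : Fin 5 → V}
    (hF : IsT5 R F) {v a b c : V} (hab : R a b) (hbc : R b c) (hca : R c a)
    (ha : R v a) (hb : R v b) (hc : R v c) : False := by
  obtain ⟨F', k, hl, rfl⟩ := exists_position5 h hU hp hF v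
  have hF' := hl.isT5
  -- Out-neighbors of `F' k` have types `k`, `k + 1`, `k + 2`, and edges respect this order: an edge
  -- from type `k + 2` back to type `k` would make its head dominate `F' k`.
  have ex : ∀ w, R (F' k) w → ∃ d : Fin 3, Typ5 R w F' (k + ![0, 1, 2] d) := by
    intro w hw
    rcases typ5_cases h hU hp hF' w k with h1 | h1 | h1 | h1 | h1
    · exact ⟨0, by simpa using h1⟩
    · exact ⟨1, h1⟩
    · exact ⟨2, h1⟩
    · have := h1.2.1
      simp only [add_assoc, Fin.reduceAdd, add_zero] at this
      exact (h.asymm hw this).elim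
    · have := h1.1
      simp only [add_assoc, Fin.reduceAdd, add_zero] at this
      exact (h.asymm hw this).elim
  have hN : ∀ w, (w = a ∨ w = b ∨ w = c) → R (F' k) w := by rintro w (rfl | rfl | rfl) <;> assumption
  obtain ⟨d, h1, h2, h3⟩ := rank_const (p := fun w d => Typ5 R w F' (k + ![0, 1, 2] d)) hab hbc hca
    (ex a ha) (ex b hb) (ex c hc) (by
      intro u v d e hu hv huv hd he
      by_contra hlt
      rcases fin3_lt_cases hlt with ⟨rfl, rfl⟩ | ⟨rfl, rfl⟩ | ⟨rfl, rfl⟩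
      · refine h.asymm huv (Typ5.edge_succ (k := k) h hU hp hF' (by simpa using he) hd)
      · refine h.asymm huv (Typ5.edge_succ (k := k + 1) h hU hp hF' he ?_)
        rw [add_assoc]; exact hd
      · refine h.asymm (hN v hv) (Typ5.edge_back (k := k) h hU hp hF' (by simpa using he) hd huv).1)
  exact not_same_typ h hU hp hF' hab hbc hca h1 h2 h3

theorem in_transitive (h : IsTour R) (hU : NoU R) (hp : IsPrime R) {F : Fin 5 → V}
    (hF : IsT5 R F) {v a b c : V} (hab : R a b) (hbc : R b c) (hca : R c a)
    (ha : R a v) (hb : R b v) (hc : R c v) : False := by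
  obtain ⟨F', k, hl, rfl⟩ := exists_position5 h hU hp hF v
  have hF' := hl.isT5
  have ex : ∀ w, R w (F' k) → ∃ d : Fin 3, Typ5 R w F' (k + ![3, 4, 0] d) := by
    intro w hw
    rcases typ5_cases h hU hp hF' w k with h1 | h1 | h1 | h1 | h1
    · exact ⟨2, by simpa using h1⟩
    · have := h1.2.2.2
      simp only [add_assoc, Fin.reduceAdd, add_zero] at this
      exact (h.asymm hw this).elim
    · have := h1.2.2.1
      simp only [add_assoc, Fin.reduceAdd, add_zero] at this
      exact (h.asymm hw this).elim
    · exact ⟨0, h1⟩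
    · exact ⟨1, h1⟩
  have hN : ∀ w, (w = a ∨ w = b ∨ w = c) → R w (F' k) := by rintro w (rfl | rfl | rfl) <;> assumption
  obtain ⟨d, h1, h2, h3⟩ := rank_const (p := fun w d => Typ5 R w F' (k + ![3, 4, 0] d)) hab hbc hca
    (ex a ha) (ex b hb) (ex c hc) (by
      intro u v d e hu hv huv hd he
      by_contra hlt
      rcases fin3_lt_cases hlt with ⟨rfl, rfl⟩ | ⟨rfl, rfl⟩ | ⟨rfl, rfl⟩
      · refine h.asymm huv (Typ5.edge_succ (k := k + 3) h hU hp hF' he ?_)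
        rw [add_assoc]; exact hd
      · refine h.asymm huv (Typ5.edge_succ (k := k + 4) h hU hp hF' he ?_)
        rw [add_assoc]; exact hd
      · have := (Typ5.edge_back (k := k + 3) h hU hp hF' he (by rw [add_assoc]; exact hd) huv).2
        simp only [add_assoc, Fin.reduceAdd, add_zero] at this
        exact h.asymm (hN u hu) this)
  exact not_same_typ h hU hp hF' hab hbc hca h1 h2 h3

/-! ### Covering a prime tournament by three sets -/

theorem exists_side (h : IsTour R) (g : V) : ∃ f : V → Fin 3,
    (∀ v, f v = 0 → R g v) ∧ (∀ v, f v = 1 → R v g) ∧ ∀ v, f v = 2 → v = g := by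
  have hv : ∀ v, ∃ i : Fin 3, (i = 0 → R g v) ∧ (i = 1 → R v g) ∧ (i = 2 → v = g) := by
    intro v
    by_cases h0 : v = g
    · exact ⟨2, by simp, by simp, fun _ => h0⟩
    · rcases h.total h0 with h1 | h1
      · exact ⟨1, by simp, fun _ => h1, by simp⟩
      · exact ⟨0, fun _ => h1, by simp, by simp⟩
  choose f hf using hv
  exact ⟨f, fun v => (hf v).1, fun v => (hf v).2.1, fun v => (hf v).2.2⟩

/-- A prime `U₃`-free tournament is covered by three sets that do not contain cyclic triangles,
even when one adds a set `H` none of whose edges is in a cyclic triangle. -/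
theorem exists_cover (h : IsTour R) (hU : NoU R) (hp : IsPrime R) (H : Set V)
    (hH : ∀ a ∈ H, ∀ b ∈ H, R a b → ∀ c, R b c → ¬ R c a) :
    ∃ f : V → Fin 3, ∀ i a b c, R a b → R b c → R c a → (f a = i ∨ a ∈ H) → (f b = i ∨ b ∈ H) →
      (f c = i ∨ c ∈ H) → False := by
  classical
  by_cases hT : ∃ F, IsT5 R F
  · obtain ⟨F, hF⟩ := hT
    obtain ⟨g, hg⟩ : ∃ g, H = ∅ ∨ g ∈ H := by
      rcases H.eq_empty_or_nonempty with hH | ⟨g, hg⟩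
      exacts [⟨F 0, Or.inl hH⟩, ⟨g, Or.inr hg⟩]
    have hedge : ∀ a b c, R a b → R b c → R c a → a ∈ H → b ∈ H → False :=
      fun a b c hab hbc hca ha hb => hH a ha b hb hab c hbc hca
    -- If `a → g`, this edge inside `H` lies in the cyclic triangle `a g c`; otherwise the whole
    -- triangle lies in the out-neighborhood of `g`.
    have into : ∀ a b c, R a b → R b c → R c a → a ∈ H → R g b → R g c → False := by
      intro a b c hab hbc hca ha hgb hgc
      rcases hg with rfl | hg
      · exact ha
      · have hne : a ≠ g := by rintro rfl; exact h.asymm hca hgc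
        rcases h.total hne with hag | hga
        · exact hH a ha g hg hag c hgc hca
        · exact out_transitive h hU hp hF hab hbc hca hga hgb hgc
    have outof : ∀ a b c, R a b → R b c → R c a → a ∈ H → R b g → R c g → False := by
      intro a b c hab hbc hca ha hbg hcg
      rcases hg with rfl | hg
      · exact ha
      · have hne : a ≠ g := by rintro rfl; exact h.asymm hab hbg
        rcases h.total hne with hag | hga
        · exact in_transitive h hU hp hF hab hbc hca hag hbg hcg
        · exact hH g hg a ha hga b hab hbg
    obtain ⟨f, c0, c1, c2⟩ := exists_side h g
    refine ⟨f, ?_⟩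
    intro i a b c hab hbc hca ha hb hc
    have m1 := hedge a b c hab hbc hca
    have m2 := hedge b c a hbc hca hab
    have m3 := hedge c a b hca hab hbc
    match i with
    | 0 =>
      have ha := ha.imp_left (c0 a)
      have hb := hb.imp_left (c0 b)
      have hc := hc.imp_left (c0 c)
      have n0 := out_transitive h hU hp hF hab hbc hca (v := g)
      have n1 := into a b c hab hbc hca
      have n2 := into b c a hbc hca hab
      have n3 := into c a b hca hab hbc
      exact no_triple ha hb hc m1 m2 m3 n0 n1 n2 n3
    | 1 =>
      have ha := ha.imp_left (c1 a)
      have hb := hb.imp_left (c1 b)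
      have hc := hc.imp_left (c1 c)
      have n0 := in_transitive h hU hp hF hab hbc hca (v := g)
      have n1 := outof a b c hab hbc hca
      have n2 := outof b c a hbc hca hab
      have n3 := outof c a b hca hab hbc
      exact no_triple ha hb hc m1 m2 m3 n0 n1 n2 n3
    | 2 =>
      have ha := ha.imp_left (c2 a)
      have hb := hb.imp_left (c2 b)
      have hc := hc.imp_left (c2 c)
      have n1 : a ≠ b := by rintro rfl; exact h.irrefl _ hab
      have n2 : b ≠ c := by rintro rfl; exact h.irrefl _ hbc
      have n3 : c ≠ a := by rintro rfl; exact h.irrefl _ hca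
      exact no_triple ha hb hc m1 m2 m3 (fun ha hb _ => n1 (ha.trans hb.symm))
        (fun _ hb hc => n2 (hb.trans hc.symm)) (fun _ hc ha => n3 (hc.trans ha.symm))
        (fun _ ha hb => n1 (ha.trans hb.symm))
  · have hl : IsLocal R := { h with
      noU := hU
      noT := fun a b c d e h1 h2 h3 h4 h5 h6 h7 h8 h9 h10 => hT ⟨![a, b, c, d, e], by
        refine isT5_of_edges 0 ?_
        exact ⟨⟨h1, h2, h3, h4, h5⟩, h6, h7, h8, h9, h10⟩⟩ }
    obtain ⟨col, hcol⟩ := hl.exists_rainbow hp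
    refine ⟨col, fun i a b c hab hbc hca ha hb hc => ?_⟩
    have n1 := hcol _ _ _ hab hbc hca
    have n2 := hcol _ _ _ hbc hca hab
    have n3 := hcol _ _ _ hca hab hbc
    have m1 := fun ha hb => hH a ha b hb hab c hbc hca
    have m2 := fun hb hc => hH b hb c hc hbc a hca hab
    have m3 := fun hc ha => hH c hc a ha hca b hab hbc
    exact no_triple ha hb hc m1 m2 m3 (fun ha hb _ => n1 (ha.trans hb.symm))
      (fun _ hb hc => n2 (hb.trans hc.symm)) (fun _ hc ha => n3 (hc.trans ha.symm))
      (fun _ ha hb => n1 (ha.trans hb.symm))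

end TournamentRel

/-! ### Containment and embeddings -/

namespace Tournament

open TournamentRel

theorem isTour (T : Tournament.{u}) : IsTour T.Adj where
  asymm := fun {u v} huv hvu => by
    have hne : u ≠ v := by rintro rfl; exact T.loopless _ huv
    rcases T.adj_xor u v hne with h | h
    · exact h.2 hvu
    · exact h.2 huv
  total := fun {u v} hne => (T.adj_xor u v hne).imp And.left And.left

/-- Every two distinct vertices of a tournament are joined by exactly one edge, so preserving edges
already forces injectivity and reflection of edges. -/
theorem nonempty_embedding_of_hom {H T : Tournament.{u}} (g : H.V → T.V)
    (hg : ∀ u v, H.Adj u v → T.Adj (g u) (g v)) : Nonempty (H.Adj ↪r T.Adj) := by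
  have hinj : Function.Injective g := by
    intro u v huv
    by_contra hne
    rcases H.isTour.total hne with h | h
    · have := hg _ _ h
      rw [huv] at this
      exact T.isTour.irrefl _ this
    · have := hg _ _ h
      rw [huv] at this
      exact T.isTour.irrefl _ this
  refine ⟨⟨⟨g, hinj⟩, fun {u v} => ⟨fun h => ?_, hg u v⟩⟩⟩
  have hne : u ≠ v := by rintro rfl; exact T.isTour.irrefl _ h
  exact (H.isTour.total hne).resolve_right fun h' => T.isTour.asymm h (hg _ _ h')

theorem contains_iff {T H : Tournament.{u}} : T.Contains H ↔ Nonempty (H.Adj ↪r T.Adj) := by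
  constructor
  · rintro ⟨S, ⟨e⟩⟩
    exact nonempty_embedding_of_hom (fun v => (e v).1) fun u v h => e.map_rel_iff.2 h
  · rintro ⟨f⟩
    exact ⟨Set.range f, ⟨⟨Equiv.ofInjective f f.injective, fun {u v} => f.map_rel_iff⟩⟩⟩

theorem isTransitiveSet_of_no_triangle {T : Tournament.{u}} {S : Set T.V}
    (h : ∀ a ∈ S, ∀ b ∈ S, ∀ c ∈ S, T.Adj a b → T.Adj b c → ¬ T.Adj c a) :
    T.IsTransitiveSet S := by
  intro v hv
  have key : ∀ a b : S, Relation.TransGen (T.induce S).Adj a b → T.Adj a b := by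
    intro a b hab
    induction hab with
    | single h => exact h
    | @tail b c hab hbc ih =>
      have hbc : T.Adj b c := hbc
      refine T.isTour.of_not ?_ (h a a.2 b b.2 c c.2 ih hbc)
      intro hca
      rw [hca] at hbc
      exact T.isTour.asymm ih hbc
  exact T.isTour.irrefl _ (key v v hv)

/-- Finding `Δ(I, A, B)` in a tournament. -/
theorem nonempty_delta_embedding {T A B : Tournament.{u}} (s : T.V) (e₁ : A.Adj ↪r T.Adj)
    (e₂ : B.Adj ↪r T.Adj) (h₁ : ∀ x, T.Adj s (e₁ x)) (h₁₂ : ∀ x y, T.Adj (e₁ x) (e₂ y))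
    (h₂ : ∀ y, T.Adj (e₂ y) s) : Nonempty ((delta ![I, A, B]).Adj ↪r T.Adj) := by
  refine nonempty_embedding_of_hom (H := delta ![I, A, B]) (fun x => match x with
    | ⟨0, _⟩ => s
    | ⟨1, v⟩ => e₁ v
    | ⟨2, v⟩ => e₂ v) ?_
  rintro _ _ (⟨i, v, w, h⟩ | ⟨i, j, v, w, hij, h⟩ | ⟨i, j, v, w, hij, h⟩)
  · match i with
    | 0 => exact h.elim
    | 1 => exact e₁.map_rel_iff.2 h
    | 2 => exact e₂.map_rel_iff.2 h
  · match i, j with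
    | 0, 0 => exact absurd hij (by decide)
    | 0, 1 => exact h₁ _
    | 0, 2 => exact absurd (by decide) h
    | 1, 0 => exact absurd hij (by decide)
    | 1, 1 => exact absurd hij (by decide)
    | 1, 2 => exact h₁₂ _ _
    | 2, 0 => exact absurd hij (by decide)
    | 2, 1 => exact absurd hij (by decide)
    | 2, 2 => exact absurd hij (by decide)
  · match i, j with
    | 0, 0 => exact absurd hij (by decide)
    | 0, 1 => exact absurd h (by decide)
    | 0, 2 => exact h₂ _
    | 1, 0 => exact absurd hij (by decide)
    | 1, 1 => exact absurd hij (by decide)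
    | 1, 2 => exact absurd h (by decide)
    | 2, 0 => exact absurd hij (by decide)
    | 2, 1 => exact absurd hij (by decide)
    | 2, 2 => exact absurd hij (by decide)

theorem noU_of_not_contains {T : Tournament.{u}} (h : ¬ T.Contains U₃) : NoU T.Adj := by
  intro a b c d e h1 h2 h3 h4 h5 h6 h7 h8 h9 h10
  refine h (contains_iff.2 (nonempty_embedding_of_hom (H := U₃)
    (fun x => (![a, b, c, d, e] : Fin 5 → T.V) x.1) ?_))
  rintro _ _ (⟨i, v, w, h⟩ | ⟨i, j, v, w, hij, h⟩ | ⟨i, j, v, w, hij, h⟩)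
  · fin_cases i <;> exact h.elim
  · fin_cases i <;> fin_cases j <;> first
      | assumption
      | exact absurd hij (by decide)
      | exact absurd (by decide) h
  · fin_cases i <;> fin_cases j <;> first
      | assumption
      | exact absurd hij (by decide)
      | exact absurd h (by decide)

/-! ### Prime quotients -/

/-- `r` is a partition into modules. -/
def IsCongruence (T : Tournament.{u}) (r : Setoid T.V) : Prop :=
  ∀ u u' v, r u u' → ¬ r u v → T.Adj u v → T.Adj u' v

theorem exists_coarsest_congruence (T : Tournament.{u}) [Nontrivial T.V] :
    ∃ r, Maximal (fun r => T.IsCongruence r ∧ r ≠ ⊤) r := by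
  have : Finite (Setoid T.V) :=
    Finite.of_injective (fun r : Setoid T.V => r.r) fun r s h => Setoid.ext fun a b => by
      exact iff_of_eq (congrFun (congrFun h a) b)
  refine (Set.toFinite {r | T.IsCongruence r ∧ r ≠ ⊤}).exists_maximal ⟨⊥, ?_, ?_⟩
  rotate_left
  · intro h
    obtain ⟨x, y, hxy⟩ := exists_pair_ne T.V
    have : (⊤ : Setoid T.V) x y := trivial
    rw [← h] at this
    exact hxy this
  rintro u u' v (rfl : u = u') _ h
  exact h

/-- The edge relation of the quotient by a partition into modules. -/
def quotAdj (T : Tournament.{u}) (r : Setoid T.V) (p q : Quotient r) : Prop := T.Adj p.out q.out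

theorem quotAdj_isTour (T : Tournament.{u}) (r : Setoid T.V) : IsTour (T.quotAdj r) where
  asymm := fun h => T.isTour.asymm h
  total := fun hne => T.isTour.total fun h => hne (Quotient.out_injective h)

theorem IsCongruence.quotAdj_iff {T : Tournament.{u}} {r : Setoid T.V} (hr : T.IsCongruence r)
    {u v : T.V} (hne : (⟦u⟧ : Quotient r) ≠ ⟦v⟧) : T.quotAdj r ⟦u⟧ ⟦v⟧ ↔ T.Adj u v := by
  have key : ∀ u u' v v' : T.V, r u u' → r v v' → ¬ r u v → T.Adj u v → T.Adj u' v' := by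
    intro u u' v v' hu hv hn huv
    have h1 := hr u u' v hu hn huv
    have hne' : u' ≠ v' := by
      rintro rfl
      exact hn (r.trans hu (r.symm hv))
    refine (T.isTour.total hne').resolve_right fun h2 => T.isTour.asymm h1 ?_
    exact hr v' v u' (r.symm hv) (fun h => hn (r.trans hu (r.trans (r.symm h) (r.symm hv)))) h2
  have hn : ¬ r u v := fun h => hne (Quotient.sound h)
  have hu : r (Quotient.out (⟦u⟧ : Quotient r)) u := Quotient.mk_out u
  have hv : r (Quotient.out (⟦v⟧ : Quotient r)) v := Quotient.mk_out v
  refine ⟨fun h => key _ _ _ _ hu hv (fun h' => hn ?_) h,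
    key _ _ _ _ (r.symm hu) (r.symm hv) hn⟩
  exact r.trans (r.symm hu) (r.trans h' hv)

theorem quotAdj_isPrime {T : Tournament.{u}} {r : Setoid T.V}
    (hr : Maximal (fun r => T.IsCongruence r ∧ r ≠ ⊤) r) : IsPrime (T.quotAdj r) := by
  intro M hM
  -- Merging the classes in a module of the quotient gives another congruence; by maximality it
  -- equals `r` or is trivial.
  let r' : Setoid T.V :=
    { r := fun u v => r u v ∨ ((⟦u⟧ : Quotient r) ∈ M ∧ (⟦v⟧ : Quotient r) ∈ M)
      iseqv := by
        refine ⟨fun u => Or.inl (r.refl u), ?_, ?_⟩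
        · rintro u v (h | h)
          · exact Or.inl (r.symm h)
          · exact Or.inr h.symm
        · rintro u v w (h | h) (h' | h')
          · exact Or.inl (r.trans h h')
          · have e : (⟦u⟧ : Quotient r) = ⟦v⟧ := Quotient.sound h
            exact Or.inr ⟨e ▸ h'.1, h'.2⟩
          · have e : (⟦v⟧ : Quotient r) = ⟦w⟧ := Quotient.sound h'
            exact Or.inr ⟨h.1, e ▸ h.2⟩
          · exact Or.inr ⟨h.1, h'.2⟩ }
  have hle : r ≤ r' := fun u v h => Or.inl h
  have hcong : T.IsCongruence r' := by
    rintro u u' v (h | h) hn huv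
    · exact hr.prop.1 u u' v h (fun h' => hn (Or.inl h')) huv
    · have hv : (⟦v⟧ : Quotient r) ∉ M := fun hv => hn (Or.inr ⟨h.1, hv⟩)
      have n1 : (⟦u⟧ : Quotient r) ≠ ⟦v⟧ := fun e => hv (e ▸ h.1)
      have n2 : (⟦u'⟧ : Quotient r) ≠ ⟦v⟧ := fun e => hv (e ▸ h.2)
      rw [← hr.prop.1.quotAdj_iff n1] at huv
      rw [← hr.prop.1.quotAdj_iff n2]
      exact (T.quotAdj_isTour r).of_not n2.symm (hM _ hv _ h.1 _ h.2 huv)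
  by_cases htop : r' = ⊤
  · rcases M.eq_empty_or_nonempty with rfl | ⟨m, hm⟩
    · exact Or.inl Set.subsingleton_empty
    · refine Or.inr (Set.eq_univ_of_forall fun q => ?_)
      have : r' q.out m.out := by rw [htop]; trivial
      rcases this with h | h
      · have e := Quotient.sound h
        rw [Quotient.out_eq, Quotient.out_eq] at e
        exact e ▸ hm
      · simpa only [Quotient.out_eq] using h.1
  · left
    intro p hp q hq
    have hle' := hr.le_of_ge ⟨hcong, htop⟩ hle
    have : r p.out q.out := hle' (Or.inr ⟨by rwa [Quotient.out_eq], by rwa [Quotient.out_eq]⟩)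
    have e := Quotient.sound this
    rwa [Quotient.out_eq, Quotient.out_eq] at e

/-! ### Palettes and the induction -/

/-- Colorings without monochromatic cyclic triangles. -/
def TriColorable (T : Tournament.{u}) (k : ℕ) : Prop :=
  ∃ φ : T.V → Fin k, ∀ a b c, T.Adj a b → T.Adj b c → T.Adj c a → φ a = φ b → φ b ≠ φ c

theorem TriColorable.colorable {T : Tournament.{u}} {k : ℕ} (h : T.TriColorable k) :
    T.Colorable k := by
  obtain ⟨φ, hφ⟩ := h
  refine ⟨φ, fun i => isTransitiveSet_of_no_triangle ?_⟩
  rintro a (ha : φ a = i) b (hb : φ b = i) c (hc : φ c = i) hab hbc hca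
  exact hφ a b c hab hbc hca (ha.trans hb.symm) (hb.trans hc.symm)

/-- The embedding of an induced subtournament. -/
theorem nonempty_embedding_induce {T H : Tournament.{u}} {S : Set T.V}
    (f : H.Adj ↪r (T.induce S).Adj) :
    ∃ e : H.Adj ↪r T.Adj, ∀ x, e x ∈ S :=
  ⟨⟨⟨fun x => (f x).1, fun _ _ h => f.injective (Subtype.ext h)⟩, fun {_ _} => f.map_rel_iff⟩,
    fun x => (f x).2⟩

/-- The classes of a partition into modules are colored with common palettes. -/
theorem triColorable_of_quotient {T : Tournament.{u}} {r : Setoid T.V} (hr : T.IsCongruence r)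
    {k : ℕ} (H : Set (Quotient r)) (f : Quotient r → Fin 3)
    (hf : ∀ i a b c, T.quotAdj r a b → T.quotAdj r b c → T.quotAdj r c a → (f a = i ∨ a ∈ H) →
      (f b = i ∨ b ∈ H) → (f c = i ∨ c ∈ H) → False)
    (hlight : ∀ q ∉ H, (T.induce {v | ⟦v⟧ = q}).TriColorable (3 ^ k))
    (hheavy : ∀ q ∈ H, (T.induce {v | ⟦v⟧ = q}).TriColorable (3 ^ (k + 1))) :
    T.TriColorable (3 ^ (k + 1)) := by
  classical
  -- The second coordinate names the palette.
  let e : Fin (3 ^ k) × Fin 3 ≃ Fin (3 ^ (k + 1)) :=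
    finProdFinEquiv.trans (finCongr (pow_succ 3 k).symm)
  have hψ : ∀ q : Quotient r, ∃ ψ : T.V → Fin (3 ^ k) × Fin 3,
      (∀ a b c : T.V, ⟦a⟧ = q → ⟦b⟧ = q → ⟦c⟧ = q → T.Adj a b → T.Adj b c → T.Adj c a →
        ψ a = ψ b → ψ b ≠ ψ c) ∧ (q ∉ H → ∀ v, (ψ v).2 = f q) := by
    intro q
    have z : Fin (3 ^ k) := ⟨0, by positivity⟩
    by_cases hq : q ∈ H
    · obtain ⟨φ, hφ⟩ := hheavy q hq
      refine ⟨fun v => if hv : ⟦v⟧ = q then e.symm (φ ⟨v, hv⟩) else (z, 0), ?_,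
        fun h => absurd hq h⟩
      intro a b c ha hb hc hab hbc hca
      simp only [ha, hb, hc, dif_pos, ne_eq, EmbeddingLike.apply_eq_iff_eq]
      exact hφ ⟨a, ha⟩ ⟨b, hb⟩ ⟨c, hc⟩ hab hbc hca
    · obtain ⟨φ, hφ⟩ := hlight q hq
      refine ⟨fun v => (if hv : ⟦v⟧ = q then φ ⟨v, hv⟩ else z, f q), ?_, fun _ _ => rfl⟩
      intro a b c ha hb hc hab hbc hca
      simp only [ha, hb, hc, dif_pos, ne_eq, Prod.mk.injEq, and_true]
      exact hφ ⟨a, ha⟩ ⟨b, hb⟩ ⟨c, hc⟩ hab hbc hca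
  choose ψ hψ1 hψ2 using hψ
  refine ⟨fun v => e (ψ ⟦v⟧ v), fun a b c hab hbc hca h1 h2 => ?_⟩
  replace h1 := e.injective h1
  replace h2 := e.injective h2
  -- A cyclic triangle with two vertices in a module lies inside it; all others map to cyclic
  -- triangles of the quotient.
  have two : ∀ {a b c : T.V}, T.Adj b c → T.Adj c a → (⟦a⟧ : Quotient r) = ⟦b⟧ →
      (⟦c⟧ : Quotient r) = ⟦a⟧ := by
    intro a b c hbc hca hab
    by_contra hne
    have hne' : (⟦b⟧ : Quotient r) ≠ ⟦c⟧ := fun h => hne (hab.trans h).symm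
    rw [← hr.quotAdj_iff hne] at hca
    rw [← hr.quotAdj_iff hne', ← hab] at hbc
    exact (T.quotAdj_isTour r).asymm hbc hca
  have mono : (⟦a⟧ : Quotient r) = ⟦b⟧ → (⟦b⟧ : Quotient r) = ⟦c⟧ → False := by
    intro ha hb
    rw [ha] at h1
    rw [← hb] at h2
    exact hψ1 ⟦b⟧ a b c ha rfl hb.symm hab hbc hca h1 h2
  have n1 : (⟦a⟧ : Quotient r) ≠ ⟦b⟧ := fun h => mono h (h.symm.trans (two hbc hca h).symm)
  have n2 : (⟦b⟧ : Quotient r) ≠ ⟦c⟧ := fun h => mono (two hca hab h) h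
  have n3 : (⟦c⟧ : Quotient r) ≠ ⟦a⟧ := fun h =>
    have h' : (⟦b⟧ : Quotient r) = ⟦c⟧ := two hab hbc h
    mono (h'.trans h).symm h'
  have pal : ∀ v : T.V, (ψ ⟦v⟧ v).2 = (ψ ⟦a⟧ a).2 →
      f ⟦v⟧ = (ψ ⟦a⟧ a).2 ∨ (⟦v⟧ : Quotient r) ∈ H := by
    intro v hv
    by_cases h : (⟦v⟧ : Quotient r) ∈ H
    · exact Or.inr h
    · exact Or.inl ((hψ2 _ h v).symm.trans hv)
  exact hf _ _ _ _ ((hr.quotAdj_iff n1).2 hab) ((hr.quotAdj_iff n2).2 hbc)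
    ((hr.quotAdj_iff n3).2 hca) (pal a rfl) (pal b (by rw [h1])) (pal c (by rw [h1, h2]))

theorem triColorable_of_free (N : ℕ) : ∀ (T : Tournament.{u}), Nat.card T.V = N → NoU T.Adj →
    ∀ n, IsEmpty ((D.{u} (n + 2)).Adj ↪r T.Adj) → T.TriColorable (3 ^ n) := by
  induction N using Nat.strong_induction_on with
  | _ N IH =>
  intro T hT hU n hD
  rcases subsingleton_or_nontrivial T.V with hs | hs
  · refine ⟨fun _ => ⟨0, by positivity⟩, fun a b c hab => ?_⟩
    rw [Subsingleton.elim a b] at hab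
    exact (T.isTour.irrefl b hab).elim
  rcases n with _ | n
  -- `D 2` is the cyclic triangle, so one color suffices.
  · refine ⟨fun _ => 0, fun a b c hab hbc hca => ?_⟩
    have point : ∀ v : T.V, ∃ e : (D.{u} 1).Adj ↪r T.Adj, ∀ x, e x = v := fun v =>
      ⟨⟨⟨fun _ => v, fun _ _ _ => Subsingleton.elim (α := PUnit) _ _⟩, fun {_ _} =>
        ⟨fun h => (T.isTour.irrefl v h).elim, fun h => h.elim⟩⟩, fun _ => rfl⟩
    obtain ⟨e₁, he₁⟩ := point b
    obtain ⟨e₂, he₂⟩ := point c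
    obtain ⟨e⟩ := nonempty_delta_embedding a e₁ e₂ (fun x => by rwa [he₁])
      (fun x y => by rwa [he₁, he₂]) (fun y => by rwa [he₂])
    exact (hD.false e).elim
  obtain ⟨r, hr⟩ := T.exists_coarsest_congruence
  have hcong := hr.prop.1
  have small : ∀ q : Quotient r, Nat.card (T.induce {v | ⟦v⟧ = q}).V < N := by
    intro q
    have hne : {v : T.V | (⟦v⟧ : Quotient r) = q} ≠ Set.univ := by
      intro h
      refine hr.prop.2 (Setoid.eq_top_iff.2 fun u v => Quotient.exact ?_)
      have hu : u ∈ {v : T.V | (⟦v⟧ : Quotient r) = q} := h ▸ Set.mem_univ u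
      have hv : v ∈ {v : T.V | (⟦v⟧ : Quotient r) = q} := h ▸ Set.mem_univ v
      exact Eq.trans hu (Eq.symm hv)
    rw [← hT]
    exact (Set.ncard_lt_card hne)
  let H : Set (Quotient r) :=
    {q | Nonempty ((D.{u} (n + 2)).Adj ↪r (T.induce {v | ⟦v⟧ = q}).Adj)}
  -- A vertex of `s` with copies of `D (n + 2)` in `p` and in `q` would form `D (n + 3)`.
  have hHedge : ∀ p ∈ H, ∀ q ∈ H, T.quotAdj r p q → ∀ s, T.quotAdj r q s →
      ¬ T.quotAdj r s p := by
    rintro p ⟨f₁⟩ q ⟨f₂⟩ hpq s hqs hsp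
    obtain ⟨e₁, he₁⟩ := nonempty_embedding_induce f₁
    obtain ⟨e₂, he₂⟩ := nonempty_embedding_induce f₂
    have irr := (T.quotAdj_isTour r).irrefl
    have npq : p ≠ q := by rintro rfl; exact irr _ hpq
    have nqs : q ≠ s := by rintro rfl; exact irr _ hqs
    have nsp : s ≠ p := by rintro rfl; exact irr _ hsp
    have lift : ∀ {u v : T.V} {p q : Quotient r}, ⟦u⟧ = p → ⟦v⟧ = q → p ≠ q →
        T.quotAdj r p q → T.Adj u v := by
      rintro u v _ _ rfl rfl hne h
      exact (hcong.quotAdj_iff hne).1 h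
    obtain ⟨e⟩ := nonempty_delta_embedding s.out e₁ e₂
      (fun x => lift (Quotient.out_eq s) (he₁ x) nsp hsp)
      (fun x y => lift (he₁ x) (he₂ y) npq hpq) (fun y => lift (he₂ y) (Quotient.out_eq s) nqs hqs)
    exact hD.false e
  obtain ⟨f, hf⟩ := exists_cover (T.quotAdj_isTour r)
    (fun a b c d e => hU a.out b.out c.out d.out e.out) (quotAdj_isPrime hr) H hHedge
  have hUq : ∀ q : Quotient r, NoU (T.induce {v | ⟦v⟧ = q}).Adj := fun q a b c d e =>
    hU a.1 b.1 c.1 d.1 e.1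
  refine triColorable_of_quotient hcong H f hf (fun q hq => ?_) (fun q hq => ?_)
  -- Light classes lower both the size and the exponent; heavy ones lower only the size.
  · exact IH _ (small q) _ rfl (hUq q) n (not_nonempty_iff.1 hq)
  · refine IH _ (small q) _ rfl (hUq q) (n + 1) ⟨fun g => ?_⟩
    obtain ⟨e, -⟩ := nonempty_embedding_induce g
    exact hD.false e

/-! ### From `D n` to the class `classD` -/

theorem nonempty_embedding_succ (n : ℕ) (hn : 1 ≤ n) :
    Nonempty ((D.{u} n).Adj ↪r (D.{u} (n + 1)).Adj) := by
  obtain ⟨m, rfl⟩ := Nat.exists_eq_add_of_le' hn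
  exact nonempty_embedding_of_hom (T := delta ![I, D.{u} (m + 1), D.{u} (m + 1)]) (fun v => ⟨1, v⟩)
    fun u v h => DeltaAdj.within (T := ![I, D.{u} (m + 1), D.{u} (m + 1)]) 1 u v h

theorem exists_embedding_of_mem_classD {F : Tournament.{u}} (hF : F ∈ classD) :
    ∃ n, 2 ≤ n ∧ Nonempty (F.Adj ↪r (D.{u} n).Adj) := by
  refine hF {F | ∃ n, 2 ≤ n ∧ Nonempty (F.Adj ↪r (D.{u} n).Adj)} ⟨?_, ?_⟩
  · rintro T ⟨n, hn, ⟨f⟩⟩ H hH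
    obtain ⟨g⟩ := contains_iff.1 hH
    exact ⟨n, hn, ⟨g.trans f⟩⟩
  · rintro T ⟨n, hn, rfl⟩
    -- The shift by one ensures that the index is at least 2, also for `D 1`.
    exact ⟨n + 1, by omega, nonempty_embedding_succ n hn⟩

theorem colorable_of_free {n : ℕ} (hn : 2 ≤ n) {T : Tournament.{u}} (hT : T.Free {D n, U₃}) :
    T.Colorable (3 ^ (n - 2)) := by
  obtain ⟨m, rfl⟩ := Nat.exists_eq_add_of_le' hn
  refine (triColorable_of_free _ T rfl (noU_of_not_contains (hT _ (by simp))) m ?_).colorable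
  exact not_nonempty_iff.1 fun h => hT (D.{u} (m + 2)) (by simp) (contains_iff.2 h)

end Tournament

theorem mainTheorem4 :
    (∀ F : Tournament.{u}, F ∈ Tournament.classD' →
      Tournament.IsHeroFor F Tournament.U₃) ∧
    (∀ n : ℕ, 2 ≤ n → ∀ T : Tournament.{u},
      T.Free {Tournament.D n, Tournament.U₃} → T.Colorable (3 ^ (n - 2))) := by
  refine ⟨fun F hF => ?_, fun n hn T hT => Tournament.colorable_of_free hn hT⟩
  obtain ⟨n, hn, ⟨f⟩⟩ := Tournament.exists_embedding_of_mem_classD hF.1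
  refine ⟨3 ^ (n - 2), fun T hT => Nat.sInf_le (Tournament.colorable_of_free hn ?_)⟩
  rintro H (rfl | rfl) hH
  · obtain ⟨g⟩ := Tournament.contains_iff.1 hH
    exact hT F (by simp) (Tournament.contains_iff.2 ⟨f.trans g⟩)
  · exact hT _ (by simp) hH
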